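/- Let $G$ be a connected semisimple Lie group and $K\subset G$ a closed subgroup such that $M=G/K$ is compact and $G$ acts almost effectively on $M$ (the elements acting trivially form a discrete subgroup). Let $\mathfrak k\subset\mathfrak g$ be the Lie algebras of $K$ and $G$, $B$ the Killing form of $\mathfrak g$, $\pi:G\to M$ the projection and $o=eK$. Suppose that $M$ is a generalized Wallach space: $\mathfrak g=\mathfrak k\oplus\mathfrak m_1\oplus\mathfrak m_2\oplus\mathfrak m_3$, where the four summands are pairwise $B$-orthogonal, each $\mathfrak m_i$ is a (nonzero) $\mathrm{Ad}(K)$-invariant irreducible subspace, and $[\mathfrak m_i,\mathfrak m_i]\subset\mathfrak k$ for $i=1,2,3$. Identify $\mathfrak m=\mathfrak m_1\oplus\mathfrak m_2\oplus\mathfrak m_3$ with $T_oM$ through $d\pi_e$. For $\lambda_1,\lambda_2,\lambda_3>0$, say that a $G$-invariant Riemannian metric $g$ on $M$ is of the form $(\lambda_1,\lambda_2,\lambda_3)$ if its value at $o$ is the inner product $\lambda_1(-B)|_{\mathfrak m_1}+\lambda_2(-B)|_{\mathfrak m_2}+\lambda_3(-B)|_{\mathfrak m_3}$ on $\mathfrak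 m$. Let $c>0$, let $g$ be such a metric, and let $X_i\in\mathfrak m_i$ $(i=1,2,3)$. If, for some $r>0$, $g$ has the form $r\cdot(1,1,c)$, $r\cdot(1,c,1)$ or $r\cdot(c,1,1)$, then the unique geodesic $\gamma$ of $(M,g)$ with $\gamma(0)=o$ and $\dot\gamma(0)=X_1+X_2+X_3$ is defined on all of $\mathbb R$ and is given, for all $t\in\mathbb R$, by $$\gamma(t)=\exp\bigl(t(X_1+X_2+cX_3)\bigr)\exp\bigl(t(1-c)X_3\bigr)\cdot o,$$ $$\gamma(t)=\exp\bigl(t(X_1+cX_2+X_3)\bigr)\exp\bigl(t(1-c)X_2\bigr)\cdot o,$$ $$\gamma(t)=\exp\bigl(t(cX_1+X_2+X_3)\bigr)\exp\bigl(t(1-c)X_1\bigr)\cdot o,$$ respectively. -/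

import Mathlib

open scoped Manifold ContDiff

noncomputable section

namespace GenWallach

/-! ### Riemannian metrics and geodesics

`M` is a smooth manifold modelled on a finite-dimensional real vector space `F`. -/

section Geodesics

variable {F : Type*} [NormedAddCommGroup F] [NormedSpace ℝ F]
  {M : Type*} [TopologicalSpace M] [ChartedSpace F M] [IsManifold 𝓘(ℝ, F) ∞ M]

/-- Smooth Riemannian metrics on `M`. -/
abbrev RiemMetric (F : Type*) [NormedAddCommGroup F] [NormedSpace ℝ F]
    (M : Type*) [TopologicalSpace M] [ChartedSpace F M] [IsManifold 𝓘(ℝ, F) ∞ M] :=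
  Bundle.ContMDiffRiemannianMetric 𝓘(ℝ, F) ∞ F (fun x : M ↦ TangentSpace 𝓘(ℝ, F) x)

/-- The metric tensor `(g_{ij})` in the coordinates given by the chart at `x`, at the
coordinate point `y`: `(u, v) ↦ g (dφ⁻¹ u, dφ⁻¹ v)`, where `φ` is the chart. -/
def chartMetric (g : RiemMetric F M) (x : M) (y : F) : F →L[ℝ] F →L[ℝ] ℝ :=
  let A : F →L[ℝ] F := mfderiv 𝓘(ℝ, F) 𝓘(ℝ, F) (extChartAt 𝓘(ℝ, F) x).symm y
  let b : F →L[ℝ] F →L[ℝ] ℝ := g.inner ((extChartAt 𝓘(ℝ, F) x).symm y)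
  b.bilinearComp A A

/-- The Christoffel symbols of the first kind in the chart at `x`, as a covector:
`Γ(u, v; w) = ½ (∂_u g(v, w) + ∂_v g(u, w) - ∂_w g(u, v))`. -/
def christoffelFirst (g : RiemMetric F M) (x : M) (y u v : F) : F →L[ℝ] ℝ :=
  let D : F →L[ℝ] F →L[ℝ] F →L[ℝ] ℝ := fderiv ℝ (chartMetric g x) y
  (1 / 2 : ℝ) • (D u v + D v u - (D.flip u).flip v)

/-- The Christoffel symbols `Γ(u, v) = Γ^k_{ij} u^i v^j ∂_k` of the Levi-Civita connection in the
chart at `x`: the first index is raised with the inverse of the metric tensor. -/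
def christoffel (g : RiemMetric F M) (x : M) (y u v : F) : F :=
  (chartMetric g x y).inverse (christoffelFirst g x y u v)

/-- `γ` is a geodesic of `(M, g)` on the open set `J ⊆ ℝ`: it is smooth on `J` and satisfies
`∇_γ' γ' = 0`, that is, in the charts of `M`, the coordinate expression
`u = φ ∘ γ` satisfies `u'' + Γ_u(u', u') = 0`. -/
def IsGeodesicOn (g : RiemMetric F M) (γ : ℝ → M) (J : Set ℝ) : Prop :=
  ContMDiffOn 𝓘(ℝ, ℝ) 𝓘(ℝ, F) ∞ γ J ∧
  ∀ x : M, ∀ t ∈ J, γ t ∈ (extChartAt 𝓘(ℝ, F) x).source →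
    let u : ℝ → F := fun s ↦ extChartAt 𝓘(ℝ, F) x (γ s)
    deriv (deriv u) t + christoffel g x (u t) (deriv u t) (deriv u t) = 0

/-- The velocity `γ'(t)`, as a point of the tangent bundle (so that it records the base point
`γ(t)` too). -/
def velocity (γ : ℝ → M) (t : ℝ) : TangentBundle 𝓘(ℝ, F) M :=
  ⟨γ t, mfderiv 𝓘(ℝ, ℝ) 𝓘(ℝ, F) γ t (1 : ℝ)⟩

/-- `γ : ℝ → M` is *the* geodesic with initial velocity `v` (a tangent vector at some point of
`M`): it is a geodesic with this initial velocity, and it agrees with every other such geodesic on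
the open interval on which the latter is defined. -/
def IsTheGeodesic (g : RiemMetric F M) (v : TangentBundle 𝓘(ℝ, F) M) (γ : ℝ → M) : Prop :=
  IsGeodesicOn g γ Set.univ ∧ velocity γ 0 = v ∧
  ∀ (J : Set ℝ) (σ : ℝ → M), IsOpen J → J.OrdConnected → (0 : ℝ) ∈ J →
    IsGeodesicOn g σ J → velocity σ 0 = v → Set.EqOn σ γ J

end Geodesics

/-! ### Lie groups -/

section LieGroups

variable {E : Type*} [NormedAddCommGroup E] [NormedSpace ℝ E]
  {G : Type*} [TopologicalSpace G] [ChartedSpace E G] [Group G]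

/-- The Lie algebra of `G`, i.e. the tangent space at the identity, with Mathlib's bracket of left
invariant vector fields. -/
abbrev LieAlg (E : Type*) [NormedAddCommGroup E] [NormedSpace ℝ E]
    (G : Type*) [TopologicalSpace G] [ChartedSpace E G] [Group G] : Type _ :=
  GroupLieAlgebra 𝓘(ℝ, E) G

open Classical in
/-- The exponential map of the Lie group `G`: `exp X = c 1`, where `c` is the integral curve, with
`c 0 = 1`, of the left invariant vector field of `X` (left invariant vector fields are complete,
so that `c` exists, and it is unique). -/
def lieExp (X : LieAlg E G) : G :=
  if h : ∃ c : ℝ → G, c 0 = 1 ∧ IsMIntegralCurve (I := 𝓘(ℝ, E)) c (mulInvariantVectorField X)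
  then h.choose 1 else 1

/-- The adjoint action of `G` on its Lie algebra: `Ad a` is the differential at the identity of
`h ↦ a h a⁻¹`. -/
def Ad (a : G) (X : LieAlg E G) : LieAlg E G :=
  (mfderiv 𝓘(ℝ, E) 𝓘(ℝ, E) (fun h : G ↦ a * h * a⁻¹) 1 : E →L[ℝ] E) X

/-- The Lie algebra `{X | exp (t X) ∈ K for all t}` of the closed subgroup `K` of `G`. (This set is
a linear subspace when `K` is closed; the span only serves to present it as one.) -/
def subgroupLieAlg (E : Type*) [NormedAddCommGroup E] [NormedSpace ℝ E]
    {G : Type*} [TopologicalSpace G] [ChartedSpace E G] [Group G] (K : Subgroup G) :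
    Submodule ℝ (LieAlg E G) :=
  Submodule.span ℝ {X | ∀ t : ℝ, lieExp (t • X) ∈ K}

/-- `p` is an `Ad(K)`-invariant subspace. -/
def AdInvariant (K : Subgroup G) (p : Submodule ℝ (LieAlg E G)) : Prop :=
  ∀ k ∈ K, ∀ X ∈ p, Ad k X ∈ p

/-- `p` is an irreducible `Ad(K)`-module. -/
def AdIrreducible (K : Subgroup G) (p : Submodule ℝ (LieAlg E G)) : Prop :=
  AdInvariant K p ∧ p ≠ ⊥ ∧ ∀ q ≤ p, AdInvariant K q → q = ⊥ ∨ q = p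

variable [LieGroup 𝓘(ℝ, E) ∞ G]

instance instLieGroupMinSmoothness : LieGroup 𝓘(ℝ, E) (minSmoothness ℝ 3) G :=
  LieGroup.of_le (n := ∞) (by
    rw [minSmoothness_of_isRCLikeNormedField]
    exact ENat.LEInfty.out)

end LieGroups

/-! ### Homogeneous spaces `G / K` -/

section Homogeneous

variable {E : Type*} [NormedAddCommGroup E] [NormedSpace ℝ E] [CompleteSpace E]
  {G : Type*} [TopologicalSpace G] [ChartedSpace E G] [Group G] [LieGroup 𝓘(ℝ, E) ∞ G]
  {F : Type*} [NormedAddCommGroup F] [NormedSpace ℝ F]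
  {K : Subgroup G} [ChartedSpace F (G ⧸ K)] [IsManifold 𝓘(ℝ, F) ∞ (G ⧸ K)]

/-- The Killing form of the Lie algebra of `G`. -/
abbrev killing (X Y : LieAlg E G) : ℝ := killingForm ℝ (LieAlg E G) X Y

/-- `G ⧸ K` carries *the* smooth structure of a homogeneous space: the one for which the projection
`G → G ⧸ K` is a smooth submersion. -/
def IsHomogeneousSpace (E : Type*) [NormedAddCommGroup E] [NormedSpace ℝ E]
    {G : Type*} [TopologicalSpace G] [ChartedSpace E G] [Group G]
    (F : Type*) [NormedAddCommGroup F] [NormedSpace ℝ F]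
    (K : Subgroup G) [ChartedSpace F (G ⧸ K)] : Prop :=
  Manifold.IsSubmersion 𝓘(ℝ, E) 𝓘(ℝ, F) ∞ (fun a : G ↦ (a : G ⧸ K))

/-- The origin `o = e K` of `G ⧸ K`. -/
def origin (K : Subgroup G) : G ⧸ K := ((1 : G) : G ⧸ K)

/-- The differential `dπ_e : 𝔤 → T_o (G ⧸ K)` of the projection. -/
def dproj (F : Type*) [NormedAddCommGroup F] [NormedSpace ℝ F]
    (K : Subgroup G) [ChartedSpace F (G ⧸ K)] (X : LieAlg E G) :
    TangentSpace 𝓘(ℝ, F) (origin K) :=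
  mfderiv 𝓘(ℝ, E) 𝓘(ℝ, F) (fun a : G ↦ (a : G ⧸ K)) 1 X

/-- `g` is a `G`-invariant metric: all translations of `G ⧸ K` are isometries. -/
def IsInvariantMetric (g : RiemMetric F (G ⧸ K)) : Prop :=
  ∀ (a : G) (x : G ⧸ K) (v w : TangentSpace 𝓘(ℝ, F) x),
    g.inner (a • x)
      (mfderiv 𝓘(ℝ, F) 𝓘(ℝ, F) (fun z : G ⧸ K ↦ a • z) x v)
      (mfderiv 𝓘(ℝ, F) 𝓘(ℝ, F) (fun z : G ⧸ K ↦ a • z) x w) = g.inner x v w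

/-- `G ⧸ K` is a generalized Wallach space with isotropy summands `𝔪 0, 𝔪 1, 𝔪 2`. -/
structure IsGeneralizedWallach (E : Type*) [NormedAddCommGroup E] [NormedSpace ℝ E]
    [CompleteSpace E]
    {G : Type*} [TopologicalSpace G] [ChartedSpace E G] [Group G] [LieGroup 𝓘(ℝ, E) ∞ G]
    (F : Type*) [NormedAddCommGroup F] [NormedSpace ℝ F]
    (K : Subgroup G) [ChartedSpace F (G ⧸ K)]
    (𝔪 : Fin 3 → Submodule ℝ (LieAlg E G)) : Prop where
  isClosed : IsClosed (K : Set G)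
  homogeneous : IsHomogeneousSpace E F K
  compact : CompactSpace (G ⧸ K)
  semisimple : LieAlgebra.IsSemisimple ℝ (LieAlg E G)
  /-- `G` acts almost effectively: the elements that act trivially form a discrete subgroup. -/
  almostEffective : DiscreteTopology (MulAction.toPermHom G (G ⧸ K)).ker
  /-- `𝔤 = 𝔨 ⊕ (𝔪 0 ⊕ 𝔪 1 ⊕ 𝔪 2)`, an orthogonal sum for the Killing form. -/
  isCompl : IsCompl (subgroupLieAlg E K) (⨆ i, 𝔪 i)
  indep : iSupIndep 𝔪
  orthogonal : ∀ i, ∀ X ∈ subgroupLieAlg E K, ∀ Y ∈ 𝔪 i, killing X Y = 0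
  pairwise_orthogonal : ∀ i j, i ≠ j → ∀ X ∈ 𝔪 i, ∀ Y ∈ 𝔪 j, killing X Y = 0
  irreducible : ∀ i, AdIrreducible K (𝔪 i)
  bracket : ∀ i, ∀ X ∈ 𝔪 i, ∀ Y ∈ 𝔪 i, ⁅X, Y⁆ ∈ subgroupLieAlg E K

/-- `g` is the `G`-invariant metric `(l₀, l₁, l₂)`: at the origin, under the identification
`dπ_e : 𝔪 0 ⊕ 𝔪 1 ⊕ 𝔪 2 ≅ T_o (G ⧸ K)`, it is
`l₀ (-B)|𝔪₀ + l₁ (-B)|𝔪₁ + l₂ (-B)|𝔪₂`, where `B` is the Killing form. -/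
structure IsDiagonalMetric (𝔪 : Fin 3 → Submodule ℝ (LieAlg E G))
    (g : RiemMetric F (G ⧸ K)) (l : Fin 3 → ℝ) : Prop where
  invariant : IsInvariantMetric g
  pos : ∀ i, 0 < l i
  inner_eq : ∀ X Y : Fin 3 → LieAlg E G, (∀ i, X i ∈ 𝔪 i) → (∀ i, Y i ∈ 𝔪 i) →
    g.inner (origin K) (dproj F K (X 0 + X 1 + X 2)) (dproj F K (Y 0 + Y 1 + Y 2)) =
      l 0 * -killing (X 0) (Y 0) + l 1 * -killing (X 1) (Y 1) + l 2 * -killing (X 2) (Y 2)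

/-- The tangent vector `X ∈ 𝔪 ≅ T_o (G ⧸ K)`, as a point of the tangent bundle. -/
def tangentAtOrigin (F : Type*) [NormedAddCommGroup F] [NormedSpace ℝ F]
    (K : Subgroup G) [ChartedSpace F (G ⧸ K)] [IsManifold 𝓘(ℝ, F) ∞ (G ⧸ K)]
    (X : LieAlg E G) : TangentBundle 𝓘(ℝ, F) (G ⧸ K) :=
  ⟨origin K, dproj F K X⟩

/-- The curve `t ↦ exp (t X) exp (t Y) · o`. -/
def twoExpCurve (K : Subgroup G) (X Y : LieAlg E G) (t : ℝ) : G ⧸ K :=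
  (lieExp (t • X) * lieExp (t • Y)) • origin K

end Homogeneous

end GenWallach

end

/-!
Write `i` for the index of the summand that carries the factor `c`, `P = X_i`, `Q` for the sum of
the other two vectors, `X = Q + c P` and `Y = (1 - c) P`, so that the curve in question is
`γ(t) = exp (t X) exp (t Y) · o` and `X + Y = Q + P`.

The bracket relations, the orthogonality of the summands and the nondegeneracy of the Killing form
`B` give `[𝔪 i, 𝔪 j] ⊆ 𝔪 k` for distinct `i, j, k`
(`IsGeneralizedWallach.lie_mem`). Hence `ad P` preserves the sum of the two other summands, so that
`Ad (exp (-t Y))` maps `Q` into this sum and fixes `P`: translated back to the origin by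
`exp (t X) exp (t Y)`, the velocity of `γ` is `Ad (exp (-t Y)) Q + P`
(`vel_twoExpCurve`). The metric multiplies the two components by `r` and `r c`, so this velocity
is dual to `-r B(Ad (exp (-t Y)) (Q + c P), ·)`. The field by which `Z ∈ 𝔤` acts on `G ⧸ K`, along
`γ`, translates to `Ad (exp (-t Y)) Ad (exp (-t X)) Z`. As `B` is `Ad`-invariant and
`Ad (exp (t X))` fixes `X`, the momentum of `γ` along this field is `-r B(X, Z)`, for all `t`.

A curve whose momenta along the fields of a transitive group of isometries are constant is a
geodesic: this is the converse of Noether's theorem. It follows by differentiating, in a chart, the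
constant momentum in `t` and the constant energy density of the variation
`(s, t) ↦ exp (s Z) · γ(t)` in `s` (`noether_coordinates`, `isGeodesicOn_of_noether`).
Uniqueness is the Picard-Lindelöf theorem in charts, together with connectedness of the interval
(`eqOn_of_isGeodesicOn`); `G ⧸ K` is Hausdorff because `K` is closed.

The basic facts on Lie groups used here are derived from the multiplication read in the chart at the
identity: completeness of left invariant fields and smoothness of one-parameter groups
(`contMDiff_lieExp_smul`), and `Ad (exp (t Y)) = exp (t ad Y)` (`AdL_lieExp_eq_exp`), where the
differential of `Ad` is found by differentiating the relation between left and right translations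
(`hasFDerivAt_AdL`).
-/

open scoped Manifold ContDiff

namespace GenWallach

set_option linter.unusedSectionVars false
set_option maxSynthPendingDepth 3

noncomputable section

open VectorField Filter Topology

/-! ### The multiplication of a Lie group in the chart at the identity -/

section Chart

variable {E : Type*} [NormedAddCommGroup E] [NormedSpace ℝ E]
  {G : Type*} [TopologicalSpace G] [ChartedSpace E G] [Group G] [LieGroup 𝓘(ℝ, E) ∞ G]

/-- The multiplication of `G` in the chart at `1`, in both variables. -/
def chartMul (E : Type*) [NormedAddCommGroup E] [NormedSpace ℝ E]
    (G : Type*) [TopologicalSpace G] [ChartedSpace E G] [Group G] (p : E × E) : E :=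
  extChartAt 𝓘(ℝ, E) (1 : G)
    ((extChartAt 𝓘(ℝ, E) (1 : G)).symm p.1 * (extChartAt 𝓘(ℝ, E) (1 : G)).symm p.2)

/-- The coordinates of the identity in the chart at `1`. -/
def chartOne (E : Type*) [NormedAddCommGroup E] [NormedSpace ℝ E]
    (G : Type*) [TopologicalSpace G] [ChartedSpace E G] [Group G] : E :=
  extChartAt 𝓘(ℝ, E) (1 : G) 1

lemma contDiffAt_chartMul {x y : E} (hx : x ∈ (extChartAt 𝓘(ℝ, E) (1 : G)).target)
    (hy : y ∈ (extChartAt 𝓘(ℝ, E) (1 : G)).target)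
    (hxy : (extChartAt 𝓘(ℝ, E) (1 : G)).symm x * (extChartAt 𝓘(ℝ, E) (1 : G)).symm y ∈
      (extChartAt 𝓘(ℝ, E) (1 : G)).source) :
    ContDiffAt ℝ ∞ (chartMul E G) (x, y) := by
  have : IsManifold 𝓘(ℝ, E) ∞ G := inferInstance
  rw [← contMDiffAt_iff_contDiffAt]
  have h1 : ∀ z ∈ (extChartAt 𝓘(ℝ, E) (1 : G)).target,
      ContMDiffAt 𝓘(ℝ, E) 𝓘(ℝ, E) ∞ (extChartAt 𝓘(ℝ, E) (1 : G)).symm z := fun z hz ↦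
    (contMDiffOn_extChartAt_symm (1 : G)).contMDiffAt
      ((isOpen_extChartAt_target (1 : G)).mem_nhds hz)
  have h2 : ContMDiffAt 𝓘(ℝ, E × E) 𝓘(ℝ, E) ∞ (fun p : E × E ↦
      (extChartAt 𝓘(ℝ, E) (1 : G)).symm p.1) (x, y) :=
    (h1 x hx).comp (x, y) contDiff_fst.contMDiff.contMDiffAt
  have h3 : ContMDiffAt 𝓘(ℝ, E × E) 𝓘(ℝ, E) ∞ (fun p : E × E ↦
      (extChartAt 𝓘(ℝ, E) (1 : G)).symm p.2) (x, y) :=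
    (h1 y hy).comp (x, y) contDiff_snd.contMDiff.contMDiffAt
  have h4 := h2.mul h3
  refine ContMDiffAt.comp (I' := 𝓘(ℝ, E)) (x, y) ?_ h4
  exact contMDiffAt_extChartAt' (by simpa using hxy)

lemma extChartAt_symm_chartOne :
    (extChartAt 𝓘(ℝ, E) (1 : G)).symm (chartOne E G) = 1 := extChartAt_to_inv (1 : G)

lemma chartOne_mem_target : chartOne E G ∈ (extChartAt 𝓘(ℝ, E) (1 : G)).target :=
  mem_extChartAt_target (1 : G)

lemma target_mem_nhds_chartOne :
    (extChartAt 𝓘(ℝ, E) (1 : G)).target ∈ 𝓝 (chartOne E G) :=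
  (isOpen_extChartAt_target (1 : G)).mem_nhds chartOne_mem_target

lemma contDiffAt_chartMul_right {x : E} (hx : x ∈ (extChartAt 𝓘(ℝ, E) (1 : G)).target) :
    ContDiffAt ℝ ∞ (chartMul E G) (x, chartOne E G) := by
  refine contDiffAt_chartMul hx chartOne_mem_target ?_
  rw [extChartAt_symm_chartOne, mul_one]
  exact (extChartAt 𝓘(ℝ, E) (1 : G)).map_target hx

lemma contDiffAt_chartMul_left {x : E} (hx : x ∈ (extChartAt 𝓘(ℝ, E) (1 : G)).target) :
    ContDiffAt ℝ ∞ (chartMul E G) (chartOne E G, x) := by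
  refine contDiffAt_chartMul chartOne_mem_target hx ?_
  rw [extChartAt_symm_chartOne, one_mul]
  exact (extChartAt 𝓘(ℝ, E) (1 : G)).map_target hx

/-- The differential at `1` of the left translation by the point with coordinates `x`, read in
the chart at `1`. -/
def chartLeft (E : Type*) [NormedAddCommGroup E] [NormedSpace ℝ E]
    (G : Type*) [TopologicalSpace G] [ChartedSpace E G] [Group G] (x : E) : E →L[ℝ] E :=
  (fderiv ℝ (chartMul E G) (x, chartOne E G)).comp (ContinuousLinearMap.inr ℝ E E)

/-- The differential at `1` of the right translation by the point with coordinates `x`, read in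
the chart at `1`. -/
def chartRight (E : Type*) [NormedAddCommGroup E] [NormedSpace ℝ E]
    (G : Type*) [TopologicalSpace G] [ChartedSpace E G] [Group G] (x : E) : E →L[ℝ] E :=
  (fderiv ℝ (chartMul E G) (chartOne E G, x)).comp (ContinuousLinearMap.inl ℝ E E)

lemma contDiffAt_chartLeft {x : E} (hx : x ∈ (extChartAt 𝓘(ℝ, E) (1 : G)).target) :
    ContDiffAt ℝ ∞ (chartLeft E G) x := by
  have h := (contDiffAt_chartMul_right hx).fderiv_right (m := ∞) (by simp)
  have h2 : ContDiffAt ℝ ∞ (fun x : E ↦ fderiv ℝ (chartMul E G) (x, chartOne E G)) x :=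
    h.comp x (contDiffAt_id.prodMk contDiffAt_const)
  exact h2.clm_comp contDiffAt_const

lemma contDiffAt_chartRight {x : E} (hx : x ∈ (extChartAt 𝓘(ℝ, E) (1 : G)).target) :
    ContDiffAt ℝ ∞ (chartRight E G) x := by
  have h := (contDiffAt_chartMul_left hx).fderiv_right (m := ∞) (by simp)
  have h2 : ContDiffAt ℝ ∞ (fun x : E ↦ fderiv ℝ (chartMul E G) (chartOne E G, x)) x :=
    h.comp x (contDiffAt_const.prodMk contDiffAt_id)
  exact h2.clm_comp contDiffAt_const

/-- The symmetry of second derivatives, for the multiplication in the chart at `1`. -/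
lemma fderiv_chartRight_apply (X Y : E) :
    fderiv ℝ (chartRight E G) (chartOne E G) Y X = fderiv ℝ (chartLeft E G) (chartOne E G) X Y := by
  set e := chartOne E G
  have hs : IsSymmSndFDerivAt ℝ (chartMul E G) (e, e) :=
    (contDiffAt_chartMul_right chartOne_mem_target).isSymmSndFDerivAt (by
      rw [minSmoothness_of_isRCLikeNormedField]; exact ENat.LEInfty.out)
  have hd : HasFDerivAt (fderiv ℝ (chartMul E G)) (fderiv ℝ (fderiv ℝ (chartMul E G)) (e, e))
      (e, e) :=
    (((contDiffAt_chartMul_right chartOne_mem_target).fderiv_right (m := ∞)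
      (by simp)).differentiableAt (by simp)).hasFDerivAt
  have hL : HasFDerivAt (fun x : E ↦ fderiv ℝ (chartMul E G) (x, e))
      ((fderiv ℝ (fderiv ℝ (chartMul E G)) (e, e)).comp (ContinuousLinearMap.inl ℝ E E)) e :=
    HasFDerivAt.comp e hd (hasFDerivAt_prodMk_left e e)
  have hR : HasFDerivAt (fun x : E ↦ fderiv ℝ (chartMul E G) (e, x))
      ((fderiv ℝ (fderiv ℝ (chartMul E G)) (e, e)).comp (ContinuousLinearMap.inr ℝ E E)) e :=
    HasFDerivAt.comp e hd (hasFDerivAt_prodMk_right e e)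
  have hL' := hL.clm_comp (hasFDerivAt_const (ContinuousLinearMap.inr ℝ E E) e)
  have hR' := hR.clm_comp (hasFDerivAt_const (ContinuousLinearMap.inl ℝ E E) e)
  change fderiv ℝ (fun x ↦ (fderiv ℝ (chartMul E G) (e, x)).comp (ContinuousLinearMap.inl ℝ E E)) e
    Y X = fderiv ℝ (fun x ↦ (fderiv ℝ (chartMul E G) (x, e)).comp (ContinuousLinearMap.inr ℝ E E)) e
    X Y
  rw [hL'.fderiv, hR'.fderiv]
  simpa using hs (0, Y) (X, 0)

/-- The differential of a map between manifolds modelled on vector spaces, as a linear map between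
the model spaces (to which all tangent spaces are definitionally equal). -/
def diffL {E F M N : Type*} [NormedAddCommGroup E] [NormedSpace ℝ E] [NormedAddCommGroup F]
    [NormedSpace ℝ F] [TopologicalSpace M] [ChartedSpace E M] [TopologicalSpace N]
    [ChartedSpace F N] (f : M → N) (x : M) : E →L[ℝ] F :=
  mfderiv 𝓘(ℝ, E) 𝓘(ℝ, F) f x

lemma hasMFDerivAt_mul_left (g h : G) : HasMFDerivAt 𝓘(ℝ, E) 𝓘(ℝ, E) (fun b : G ↦ g * b) h
    (diffL (fun b : G ↦ g * b) h : E →L[ℝ] E) :=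
  ((contMDiff_mul_left (I := 𝓘(ℝ, E)) (n := ∞) (a := g)).mdifferentiableAt (by simp)).hasMFDerivAt

lemma hasMFDerivAt_mul_right (g h : G) : HasMFDerivAt 𝓘(ℝ, E) 𝓘(ℝ, E) (fun b : G ↦ b * g) h
    (diffL (fun b : G ↦ b * g) h : E →L[ℝ] E) :=
  ((contMDiff_mul_right (I := 𝓘(ℝ, E)) (n := ∞) (a := g)).mdifferentiableAt (by simp)).hasMFDerivAt

lemma hasMFDerivAt_extChartAt_symm_chartOne :
    HasMFDerivAt 𝓘(ℝ, E) 𝓘(ℝ, E) (extChartAt 𝓘(ℝ, E) (1 : G)).symm (chartOne E G)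
      (ContinuousLinearMap.id ℝ E) := by
  have : IsManifold 𝓘(ℝ, E) ∞ G := inferInstance
  have : IsManifold 𝓘(ℝ, E) 1 G := IsManifold.of_le (n := ∞) (by exact ENat.LEInfty.out)
  have h := (mdifferentiableWithinAt_extChartAt_symm (I := 𝓘(ℝ, E))
    (chartOne_mem_target (E := E) (G := G))).hasMFDerivWithinAt
  have h2 := mfderivWithin_range_extChartAt_symm (I := 𝓘(ℝ, E)) (x := (1 : G))
  rw [chartOne] at *
  rw [h2] at h
  exact HasMFDerivWithinAt.hasMFDerivAt h (by simp)

/-- The differential at `1` of a map `f` with `f 1` in the chart domain, read in the chart at `1`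
on both sides. -/
lemma hasFDerivAt_extChartAt_comp {f : G → G} {g : G} {D : E →L[ℝ] E}
    (hg : g ∈ (extChartAt 𝓘(ℝ, E) (1 : G)).source) (hfg : f 1 = g)
    (hf : HasMFDerivAt 𝓘(ℝ, E) 𝓘(ℝ, E) f 1 D) :
    HasFDerivAt (fun z ↦ extChartAt 𝓘(ℝ, E) (1 : G) (f ((extChartAt 𝓘(ℝ, E) (1 : G)).symm z)))
      (((diffL (extChartAt 𝓘(ℝ, E) (1 : G)) g : E →L[ℝ] E)).comp D)
      (chartOne E G) := by
  subst hfg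
  have : IsManifold 𝓘(ℝ, E) ∞ G := inferInstance
  have : IsManifold 𝓘(ℝ, E) 1 G := IsManifold.of_le (n := ∞) (by exact ENat.LEInfty.out)
  have h3 : HasMFDerivAt 𝓘(ℝ, E) 𝓘(ℝ, E) (extChartAt 𝓘(ℝ, E) (1 : G)) (f 1)
      (diffL (extChartAt 𝓘(ℝ, E) (1 : G)) (f 1) : E →L[ℝ] E) :=
    (mdifferentiableAt_extChartAt (by simpa using hg)).hasMFDerivAt
  have h4 := h3.comp (1 : G) hf
  have h5 : HasMFDerivAt 𝓘(ℝ, E) 𝓘(ℝ, E) (extChartAt 𝓘(ℝ, E) (1 : G) ∘ f)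
      ((extChartAt 𝓘(ℝ, E) (1 : G)).symm (chartOne E G))
      (((diffL (extChartAt 𝓘(ℝ, E) (1 : G)) (f 1) : E →L[ℝ] E)).comp D) := by
    rw [extChartAt_symm_chartOne]; exact h4
  have h6 := h5.comp (chartOne E G) hasMFDerivAt_extChartAt_symm_chartOne
  exact hasMFDerivAt_iff_hasFDerivAt.1 h6

/-- `chartLeft E G x` is indeed the differential of a left translation. -/
lemma mfderiv_extChartAt_mul_left {x : E} (hx : x ∈ (extChartAt 𝓘(ℝ, E) (1 : G)).target) :
    (diffL (extChartAt 𝓘(ℝ, E) (1 : G))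
      ((extChartAt 𝓘(ℝ, E) (1 : G)).symm x) : E →L[ℝ] E).comp
      (diffL (fun b : G ↦ (extChartAt 𝓘(ℝ, E) (1 : G)).symm x * b) (1 : G) :
        E →L[ℝ] E) = chartLeft E G x := by
  have h1 := hasFDerivAt_extChartAt_comp (f := fun b : G ↦ (extChartAt 𝓘(ℝ, E) (1 : G)).symm x * b)
    ((extChartAt 𝓘(ℝ, E) (1 : G)).map_target hx) (by simp) (hasMFDerivAt_mul_left _ 1)
  have h2 := ((contDiffAt_chartMul_right (G := G) hx).differentiableAt (by simp)).hasFDerivAt.comp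
    (chartOne E G) (hasFDerivAt_prodMk_right x (chartOne E G))
  exact h1.unique h2

/-- `chartRight E G x` is indeed the differential of a right translation. -/
lemma mfderiv_extChartAt_mul_right {x : E} (hx : x ∈ (extChartAt 𝓘(ℝ, E) (1 : G)).target) :
    (diffL (extChartAt 𝓘(ℝ, E) (1 : G))
      ((extChartAt 𝓘(ℝ, E) (1 : G)).symm x) : E →L[ℝ] E).comp
      (diffL (fun b : G ↦ b * (extChartAt 𝓘(ℝ, E) (1 : G)).symm x) (1 : G) :
        E →L[ℝ] E) = chartRight E G x := by
  have h1 := hasFDerivAt_extChartAt_comp (f := fun b : G ↦ b * (extChartAt 𝓘(ℝ, E) (1 : G)).symm x)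
    ((extChartAt 𝓘(ℝ, E) (1 : G)).map_target hx) (by simp) (hasMFDerivAt_mul_right _ 1)
  have h2 := ((contDiffAt_chartMul_left (G := G) hx).differentiableAt (by simp)).hasFDerivAt.comp
    (chartOne E G) (f := fun z : E ↦ (z, x)) (hasFDerivAt_prodMk_left (chartOne E G) x)
  exact h1.unique h2

lemma chartMul_chartOne_left {x : E} (hx : x ∈ (extChartAt 𝓘(ℝ, E) (1 : G)).target) :
    chartMul E G (chartOne E G, x) = x := by
  simp only [chartMul, extChartAt_symm_chartOne, one_mul]
  exact (extChartAt 𝓘(ℝ, E) (1 : G)).right_inv hx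

lemma chartMul_chartOne_right {x : E} (hx : x ∈ (extChartAt 𝓘(ℝ, E) (1 : G)).target) :
    chartMul E G (x, chartOne E G) = x := by
  simp only [chartMul, extChartAt_symm_chartOne, mul_one]
  exact (extChartAt 𝓘(ℝ, E) (1 : G)).right_inv hx

lemma chartLeft_chartOne : chartLeft E G (chartOne E G) = ContinuousLinearMap.id ℝ E := by
  have h2 := ((contDiffAt_chartMul_right (G := G) chartOne_mem_target).differentiableAt
    (by simp)).hasFDerivAt.comp (chartOne E G)
    (hasFDerivAt_prodMk_right (chartOne E G) (chartOne E G))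
  refine h2.unique ((hasFDerivAt_id (𝕜 := ℝ) (chartOne E G)).congr_of_eventuallyEq ?_)
  filter_upwards [target_mem_nhds_chartOne (E := E) (G := G)] with x hx
  exact chartMul_chartOne_left hx

lemma chartRight_chartOne : chartRight E G (chartOne E G) = ContinuousLinearMap.id ℝ E := by
  have h2 := ((contDiffAt_chartMul_right (G := G) chartOne_mem_target).differentiableAt
    (by simp)).hasFDerivAt.comp (chartOne E G) (f := fun z : E ↦ (z, chartOne E G))
    (hasFDerivAt_prodMk_left (chartOne E G) (chartOne E G))
  refine h2.unique ((hasFDerivAt_id (𝕜 := ℝ) (chartOne E G)).congr_of_eventuallyEq ?_)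
  filter_upwards [target_mem_nhds_chartOne (E := E) (G := G)] with x hx
  exact chartMul_chartOne_right hx

end Chart

/-! ### The adjoint action of a Lie group and its differential -/

section Adjoint

variable {E : Type*} [NormedAddCommGroup E] [NormedSpace ℝ E]
  {G : Type*} [TopologicalSpace G] [ChartedSpace E G] [Group G] [LieGroup 𝓘(ℝ, E) ∞ G]

/-- `Ad a` as a continuous linear map of the model space, to which the Lie algebra is
definitionally equal. -/
def AdL (a : G) : E →L[ℝ] E := mfderiv 𝓘(ℝ, E) 𝓘(ℝ, E) (fun h : G ↦ a * h * a⁻¹) (1 : G)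

lemma hasMFDerivAt_conj (a : G) : HasMFDerivAt 𝓘(ℝ, E) 𝓘(ℝ, E) (fun h : G ↦ a * h * a⁻¹) 1
    (AdL a : E →L[ℝ] E) := by
  have h : ContMDiff 𝓘(ℝ, E) 𝓘(ℝ, E) ∞ (fun h : G ↦ a * h * a⁻¹) :=
    (contMDiff_mul_right (a := a⁻¹)).comp contMDiff_mul_left
  exact (h.mdifferentiableAt (by simp)).hasMFDerivAt

lemma hasMFDerivAt_congr_point {f : G → G} {x y : G} {D : E →L[ℝ] E} (h : x = y)
    (hf : HasMFDerivAt 𝓘(ℝ, E) 𝓘(ℝ, E) f x D) : HasMFDerivAt 𝓘(ℝ, E) 𝓘(ℝ, E) f y D := by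
  subst h; exact hf

/-- Left translation by `a` is conjugation by `a` followed by right translation by `a`. -/
lemma mfderiv_mul_left_eq (a : G) :
    (diffL (fun b : G ↦ a * b) (1 : G) : E →L[ℝ] E) =
      (diffL (fun b : G ↦ b * a) (1 : G) : E →L[ℝ] E).comp (AdL a) := by
  have h1 : HasMFDerivAt 𝓘(ℝ, E) 𝓘(ℝ, E) (fun b : G ↦ b * a) (a * 1 * a⁻¹)
    (diffL (fun b : G ↦ b * a) (1 : G) : E →L[ℝ] E) :=
    hasMFDerivAt_congr_point (by simp) (hasMFDerivAt_mul_right a 1)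
  have h2 := h1.comp (1 : G) (hasMFDerivAt_conj a)
  have h3 : (fun b : G ↦ b * a) ∘ (fun h : G ↦ a * h * a⁻¹) = fun b ↦ a * b := by
    ext; simp
  rw [h3] at h2
  exact (hasMFDerivAt_unique h2 (hasMFDerivAt_mul_left a 1)).symm

lemma AdL_mul (a b : G) : (AdL (a * b) : E →L[ℝ] E) = (AdL a).comp (AdL b) := by
  have h1 : HasMFDerivAt 𝓘(ℝ, E) 𝓘(ℝ, E) (fun h : G ↦ a * h * a⁻¹) (b * 1 * b⁻¹)
    (AdL a : E →L[ℝ] E) := hasMFDerivAt_congr_point (by simp) (hasMFDerivAt_conj a)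
  have h2 := h1.comp (1 : G) (hasMFDerivAt_conj b)
  have h3 : (fun h : G ↦ a * h * a⁻¹) ∘ (fun h : G ↦ b * h * b⁻¹) =
      fun h ↦ (a * b) * h * (a * b)⁻¹ := by
    ext; simp [mul_assoc]
  rw [h3] at h2
  exact hasMFDerivAt_unique (hasMFDerivAt_conj (a * b)) h2

lemma AdL_one : (AdL (1 : G) : E →L[ℝ] E) = ContinuousLinearMap.id ℝ E := by
  have h := hasMFDerivAt_conj (E := E) (1 : G)
  have h3 : (fun h : G ↦ 1 * h * 1⁻¹) = id := by ext; simp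
  rw [h3] at h
  exact hasMFDerivAt_unique h (hasMFDerivAt_id (1 : G))

/-- Left translations are right translations after conjugation, in the chart at `1`. -/
lemma chartLeft_eq {x : E} (hx : x ∈ (extChartAt 𝓘(ℝ, E) (1 : G)).target) :
    chartLeft E G x = (chartRight E G x).comp (AdL ((extChartAt 𝓘(ℝ, E) (1 : G)).symm x)) := by
  rw [← mfderiv_extChartAt_mul_left hx, ← mfderiv_extChartAt_mul_right hx, mfderiv_mul_left_eq,
    ContinuousLinearMap.comp_assoc]

/-- In the chart at `1`, the left invariant vector field of `X` is `y ↦ chartLeft y X`. -/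
lemma mpullbackWithin_mulInvariantVectorField (X : LieAlg E G) {y : E}
    (hy : y ∈ (extChartAt 𝓘(ℝ, E) (1 : G)).target) :
    mpullbackWithin 𝓘(ℝ, E) 𝓘(ℝ, E) (extChartAt 𝓘(ℝ, E) (1 : G)).symm (mulInvariantVectorField X)
      (Set.range 𝓘(ℝ, E)) y = chartLeft E G y X := by
  have : IsManifold 𝓘(ℝ, E) ∞ G := inferInstance
  have : IsManifold 𝓘(ℝ, E) 1 G := IsManifold.of_le (n := ∞) (by exact ENat.LEInfty.out)
  have h := ContinuousLinearMap.inverse_eq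
    (mfderivWithin_extChartAt_symm_comp_mfderiv_extChartAt (I := 𝓘(ℝ, E)) hy)
    (mfderiv_extChartAt_comp_mfderivWithin_extChartAt_symm (I := 𝓘(ℝ, E)) hy)
  rw [mpullbackWithin_apply, h, ← mfderiv_extChartAt_mul_left hy]
  rfl

/-- The bracket of left invariant fields, in terms of the left translations in the chart at `1`. -/
lemma bracket_eq [CompleteSpace E] (X Y : LieAlg E G) :
    (⁅X, Y⁆ : LieAlg E G) = (fderiv ℝ (chartLeft E G) (chartOne E G) X Y -
      fderiv ℝ (chartLeft E G) (chartOne E G) Y X : E) := by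
  have : IsManifold 𝓘(ℝ, E) ∞ G := inferInstance
  have : IsManifold 𝓘(ℝ, E) 1 G := IsManifold.of_le (n := ∞) (by exact ENat.LEInfty.out)
  have hd : HasFDerivAt (chartLeft E G) (fderiv ℝ (chartLeft E G) (chartOne E G)) (chartOne E G) :=
    ((contDiffAt_chartLeft chartOne_mem_target).differentiableAt (by simp)).hasFDerivAt
  have hev (Z : LieAlg E G) : mpullbackWithin 𝓘(ℝ, E) 𝓘(ℝ, E) (extChartAt 𝓘(ℝ, E) (1 : G)).symm
      (mulInvariantVectorField Z) (Set.range 𝓘(ℝ, E)) =ᶠ[𝓝 (chartOne E G)]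
        fun y ↦ chartLeft E G y Z := by
    filter_upwards [target_mem_nhds_chartOne (E := E) (G := G)] with y hy
    exact mpullbackWithin_mulInvariantVectorField Z hy
  have hder (Z W : E) : fderiv ℝ (fun y ↦ chartLeft E G y Z) (chartOne E G) W =
      fderiv ℝ (chartLeft E G) (chartOne E G) W Z := by
    have := hd.clm_apply (hasFDerivAt_const Z (chartOne E G))
    rw [this.fderiv]; simp
  have key (X Y : E) (V W : E → E) (hV : V =ᶠ[𝓝 (chartOne E G)] fun y ↦ chartLeft E G y X)
      (hW : W =ᶠ[𝓝 (chartOne E G)] fun y ↦ chartLeft E G y Y) : lieBracketWithin ℝ V W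
      ((extChartAt 𝓘(ℝ, E) (1 : G)).symm ⁻¹' Set.univ ∩ Set.range 𝓘(ℝ, E)) (chartOne E G) =
      fderiv ℝ (chartLeft E G) (chartOne E G) X Y -
      fderiv ℝ (chartLeft E G) (chartOne E G) Y X := by
    have hs : ((extChartAt 𝓘(ℝ, E) (1 : G)).symm ⁻¹' Set.univ ∩ Set.range 𝓘(ℝ, E)) = Set.univ := by
      simp
    rw [hs, lieBracketWithin_univ, hV.lieBracket_vectorField_eq hW]
    simp only [lieBracket]
    rw [hder, hder, chartLeft_chartOne]
    rfl
  have h2 : mfderiv 𝓘(ℝ, E) 𝓘(ℝ, E) (extChartAt 𝓘(ℝ, E) (1 : G)) 1 =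
    ContinuousLinearMap.id ℝ E := mfderiv_extChartAt_self (I := 𝓘(ℝ, E)) (x := (1 : G))
  rw [GroupLieAlgebra.bracket_def, ← mlieBracketWithin_univ, mlieBracketWithin_apply, h2]
  refine Eq.trans (congrArg _ (key X Y _ _ (hev X) (hev Y))) ?_
  exact congrArg (fun f : E →L[ℝ] E ↦ f _) (ContinuousLinearMap.inverse_id)

/-- The adjoint representation of the Lie algebra, as the differential of `Ad` read in the chart at
`1`. -/
def adL (G : Type*) [TopologicalSpace G] [ChartedSpace E G] [Group G] (Y : E) : E →L[ℝ] E :=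
  fderiv ℝ (chartLeft E G) (chartOne E G) Y - fderiv ℝ (chartRight E G) (chartOne E G) Y

/-- The symmetry of the second derivative of the multiplication turns the derivative of the right
translations into one of the left translations, and so `adL` into the bracket. -/
lemma adL_apply [CompleteSpace E] (Y X : LieAlg E G) : (adL G Y : E →L[ℝ] E) X = ⁅Y, X⁆ := by
  refine Eq.trans ?_ (bracket_eq Y X).symm
  exact congrArg (fun z : E ↦ fderiv ℝ (chartLeft E G) (chartOne E G) Y X - z)
    (fderiv_chartRight_apply (E := E) (G := G) X Y)

/-- The differential at `1` of `Ad` is the adjoint representation: differentiate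
`chartLeft x = chartRight x ∘ Ad x`. -/
lemma hasFDerivAt_AdL [CompleteSpace E] :
    HasFDerivAt (fun x ↦ (AdL ((extChartAt 𝓘(ℝ, E) (1 : G)).symm x) : E →L[ℝ] E))
      (fderiv ℝ (chartLeft E G) (chartOne E G) - fderiv ℝ (chartRight E G) (chartOne E G))
      (chartOne E G) := by
  set e := chartOne E G
  have hL : HasFDerivAt (chartLeft E G) (fderiv ℝ (chartLeft E G) e) e :=
    ((contDiffAt_chartLeft chartOne_mem_target).differentiableAt (by simp)).hasFDerivAt
  have hRc := contDiffAt_chartRight (E := E) (G := G) chartOne_mem_target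
  have hR : HasFDerivAt (chartRight E G) (fderiv ℝ (chartRight E G) e) e :=
    (hRc.differentiableAt (by simp)).hasFDerivAt
  have hRe : chartRight E G e = ((ContinuousLinearEquiv.refl ℝ E : E ≃L[ℝ] E) : E →L[ℝ] E) :=
    chartRight_chartOne
  -- `Ad` is differentiable because `Ad x = (chartRight x)⁻¹ ∘ chartLeft x` near the identity
  have hinv : DifferentiableAt ℝ (fun x ↦ (chartRight E G x).inverse) e := by
    have h1 : ContDiffAt ℝ 1 (ContinuousLinearMap.inverse (R := ℝ) (M := E) (M₂ := E))
      (chartRight E G e) := by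
      rw [hRe]; exact contDiffAt_map_inverse _
    exact (h1.differentiableAt (by simp)).comp e hR.differentiableAt
  have hAev : (fun x ↦ (AdL ((extChartAt 𝓘(ℝ, E) (1 : G)).symm x) : E →L[ℝ] E)) =ᶠ[𝓝 e]
      fun x ↦ (chartRight E G x).inverse.comp (chartLeft E G x) := by
    have h1 : ∀ᶠ x in 𝓝 e, chartRight E G x ∈ Set.range ((↑) : (E ≃L[ℝ] E) → (E →L[ℝ] E)) := by
      refine hRc.continuousAt.eventually_mem ?_
      rw [hRe]; exact ContinuousLinearEquiv.nhds _
    filter_upwards [h1, target_mem_nhds_chartOne (E := E) (G := G)] with x ⟨r, hr⟩ hx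
    rw [chartLeft_eq hx, ← hr, ContinuousLinearMap.inverse_equiv]
    ext v; simp
  have hA : DifferentiableAt ℝ
      (fun x ↦ (AdL ((extChartAt 𝓘(ℝ, E) (1 : G)).symm x) : E →L[ℝ] E)) e :=
    (hinv.clm_comp hL.differentiableAt).congr_of_eventuallyEq hAev
  -- the product rule for `chartLeft x = chartRight x ∘ Ad x` at the identity, where both
  -- `chartRight` and `Ad` are the identity map
  have hprod := hR.clm_comp hA.hasFDerivAt
  have heq := (hL.congr_of_eventuallyEq (f₁ := fun x ↦ (chartRight E G x).comp
    (AdL ((extChartAt 𝓘(ℝ, E) (1 : G)).symm x) : E →L[ℝ] E)) (by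
      filter_upwards [target_mem_nhds_chartOne (E := E) (G := G)] with x hx
      exact (chartLeft_eq hx).symm)).unique hprod
  convert hA.hasFDerivAt using 1
  ext u v
  have h3 := congrArg (fun f : E →L[ℝ] E →L[ℝ] E ↦ f u v) heq
  have hAe : (AdL ((extChartAt 𝓘(ℝ, E) (1 : G)).symm e) : E →L[ℝ] E) =
    ContinuousLinearMap.id ℝ E := by
    rw [extChartAt_symm_chartOne, AdL_one]
  have hRe' : chartRight E G e = ContinuousLinearMap.id ℝ E := chartRight_chartOne
  simp only [hAe, hRe', add_apply, ContinuousLinearMap.comp_apply,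
    ContinuousLinearMap.compL_apply, ContinuousLinearMap.flip_apply,
    ContinuousLinearMap.id_apply] at h3
  simp only [sub_apply, h3]
  simp

/-- The derivative of `Ad` along a curve through `1` with velocity `Y`. -/
lemma hasDerivAt_AdL_comp [CompleteSpace E] {c : ℝ → G} {Y : E} (hc0 : c 0 = 1)
    (hc : HasMFDerivAt 𝓘(ℝ, ℝ) 𝓘(ℝ, E) c 0 (ContinuousLinearMap.toSpanSingleton ℝ Y)) :
    HasDerivAt (fun t ↦ (AdL (c t) : E →L[ℝ] E)) (adL G Y) 0 := by
  have : IsManifold 𝓘(ℝ, E) ∞ G := inferInstance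
  have : IsManifold 𝓘(ℝ, E) 1 G := IsManifold.of_le (n := ∞) (by exact ENat.LEInfty.out)
  have h1 : HasMFDerivAt 𝓘(ℝ, E) 𝓘(ℝ, E) (extChartAt 𝓘(ℝ, E) (1 : G)) (c 0)
      (ContinuousLinearMap.id ℝ E) := by
    rw [hc0]
    have h := (mdifferentiableAt_extChartAt (I := 𝓘(ℝ, E))
      (mem_chart_source E (1 : G))).hasMFDerivAt
    rw [mfderiv_extChartAt_self] at h
    exact h
  have h2 := (h1.comp (0 : ℝ) hc)
  have h3 : HasFDerivAt ((extChartAt 𝓘(ℝ, E) (1 : G)) ∘ c)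
    (ContinuousLinearMap.toSpanSingleton ℝ Y) 0 := hasMFDerivAt_iff_hasFDerivAt.1 h2
  have h4 : HasFDerivAt (fun x ↦ (AdL ((extChartAt 𝓘(ℝ, E) (1 : G)).symm x) : E →L[ℝ] E))
      (fderiv ℝ (chartLeft E G) (chartOne E G) - fderiv ℝ (chartRight E G) (chartOne E G))
      (((extChartAt 𝓘(ℝ, E) (1 : G)) ∘ c) 0) := by
    simp only [Function.comp, hc0]
    exact hasFDerivAt_AdL
  have h5 := (h4.comp (0 : ℝ) h3).hasDerivAt
  have h6 : HasDerivAt (fun t ↦ (AdL ((extChartAt 𝓘(ℝ, E) (1 : G)).symm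
      (extChartAt 𝓘(ℝ, E) (1 : G) (c t))) : E →L[ℝ] E)) (adL G Y) 0 := by
    refine h5.congr_deriv ?_
    simp [adL]
  refine h6.congr_of_eventuallyEq ?_
  have h7 : ∀ᶠ t in 𝓝 (0 : ℝ), c t ∈ (extChartAt 𝓘(ℝ, E) (1 : G)).source :=
    hc.continuousAt.eventually_mem (by rw [hc0]; exact extChartAt_source_mem_nhds (1 : G))
  filter_upwards [h7] with t ht
  rw [(extChartAt 𝓘(ℝ, E) (1 : G)).left_inv ht]

end Adjoint

/-! ### The exponential map -/

section Exponential

variable {E : Type*} [NormedAddCommGroup E] [NormedSpace ℝ E]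
  {G : Type*} [TopologicalSpace G] [ChartedSpace E G] [Group G] [LieGroup 𝓘(ℝ, E) ∞ G]

lemma isManifold_one_of_lieGroup : IsManifold 𝓘(ℝ, E) 1 G := by
  have : IsManifold 𝓘(ℝ, E) ∞ G := inferInstance
  exact IsManifold.of_le (n := ∞) (by exact ENat.LEInfty.out)

/-- A solution of a smooth autonomous differential equation is smooth. -/
lemma contDiffOn_of_hasDerivAt_comp {v : E → E} {T : Set E} (hv : ContDiffOn ℝ ∞ v T) {u : ℝ → E}
    {S : Set ℝ} (hS : IsOpen S) (hST : Set.MapsTo u S T)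
    (hu : ∀ t ∈ S, HasDerivAt u (v (u t)) t) : ContDiffOn ℝ ∞ u S := by
  rw [contDiffOn_infty]
  intro n
  induction n with
  | zero =>
    exact contDiffOn_zero.2 fun t ht ↦ (hu t ht).continuousAt.continuousWithinAt
  | succ n ih =>
    push_cast
    rw [contDiffOn_succ_iff_deriv_of_isOpen hS]
    refine ⟨fun t ht ↦ (hu t ht).differentiableAt.differentiableWithinAt, by simp, ?_⟩
    have h1 : ContDiffOn ℝ n (v ∘ u) S :=
      (hv.of_le (by exact_mod_cast le_top)).comp ih hST
    exact h1.congr fun t ht ↦ (hu t ht).deriv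

/-- Left invariant vector fields are left invariant. -/
lemma diffL_mul_left_apply (g h : G) (X : LieAlg E G) :
    (diffL (fun b : G ↦ g * b) h : E →L[ℝ] E) (mulInvariantVectorField X h) =
      mulInvariantVectorField X (g * h) := by
  have h1 : HasMFDerivAt 𝓘(ℝ, E) 𝓘(ℝ, E) (fun b : G ↦ g * b) (h * 1)
    (diffL (fun b : G ↦ g * b) h : E →L[ℝ] E) :=
    hasMFDerivAt_congr_point (by simp) (hasMFDerivAt_mul_left g h)
  have h2 := h1.comp (1 : G) (hasMFDerivAt_mul_left h 1)
  have h3 : (fun b : G ↦ g * b) ∘ (fun b : G ↦ h * b) = fun b ↦ (g * h) * b := by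
    ext; simp [mul_assoc]
  rw [h3] at h2
  have h4 := hasMFDerivAt_unique h2 (hasMFDerivAt_mul_left (g * h) 1)
  exact congrArg (fun f : E →L[ℝ] E ↦ f X) h4

lemma comp_smulRight_one {E F : Type*} [NormedAddCommGroup E] [NormedSpace ℝ E]
    [NormedAddCommGroup F] [NormedSpace ℝ F] (L : E →L[ℝ] F) (v : E) :
    L.comp ((1 : ℝ →L[ℝ] ℝ).smulRight v) = (1 : ℝ →L[ℝ] ℝ).smulRight (L v) := by
  ext; simp

lemma isMIntegralCurveOn_mul_left {c : ℝ → G} {X : LieAlg E G} {s : Set ℝ}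
    (hc : IsMIntegralCurveOn (I := 𝓘(ℝ, E)) c (mulInvariantVectorField X) s) (g : G) :
    IsMIntegralCurveOn (I := 𝓘(ℝ, E)) (fun t ↦ g * c t) (mulInvariantVectorField X) s := by
  intro t ht
  refine ((hasMFDerivAt_mul_left g (c t)).comp_hasMFDerivWithinAt t (hc t ht)).congr_mfderiv ?_
  rw [← diffL_mul_left_apply]
  exact comp_smulRight_one (E := E) (F := E) _ _

lemma isMIntegralCurve_mul_left {c : ℝ → G} {X : LieAlg E G}
    (hc : IsMIntegralCurve (I := 𝓘(ℝ, E)) c (mulInvariantVectorField X)) (g : G) :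
    IsMIntegralCurve (I := 𝓘(ℝ, E)) (fun t ↦ g * c t) (mulInvariantVectorField X) := by
  rw [isMIntegralCurve_iff_isMIntegralCurveOn] at hc ⊢
  exact isMIntegralCurveOn_mul_left hc g

lemma contMDiff_one_mulInvariantVectorField (X : LieAlg E G) :
    ContMDiff 𝓘(ℝ, E) 𝓘(ℝ, E).tangent 1
      (fun g : G ↦ (⟨g, mulInvariantVectorField X g⟩ : TangentBundle 𝓘(ℝ, E) G)) :=
  (contMDiff_mulInvariantVectorField X).of_le (by
    rw [minSmoothness_of_isRCLikeNormedField]; exact one_le_two)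

variable [CompleteSpace E] [T2Space G]

/-- Left invariant vector fields are complete. -/
lemma exists_isMIntegralCurve_mulInvariantVectorField (X : LieAlg E G) :
    ∃ c : ℝ → G, c 0 = 1 ∧ IsMIntegralCurve (I := 𝓘(ℝ, E)) c (mulInvariantVectorField X) := by
  have := isManifold_one_of_lieGroup (E := E) (G := G)
  have hv := contMDiff_one_mulInvariantVectorField X
  obtain ⟨c, hc0, hc⟩ := exists_isMIntegralCurveAt_of_contMDiffAt_boundaryless (I := 𝓘(ℝ, E)) 0
    (hv.contMDiffAt (x := 1))
  obtain ⟨ε, hε, hc⟩ := isMIntegralCurveAt_iff'.1 hc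
  refine exists_isMIntegralCurve_of_isMIntegralCurveOn hv hε (fun g ↦ ?_) 1
  refine ⟨fun t ↦ g * c t, by simp [hc0], isMIntegralCurveOn_mul_left ?_ g⟩
  simpa [Real.ball_eq_Ioo] using hc

lemma isMIntegralCurve_unique {X : LieAlg E G} {c c' : ℝ → G}
    (hc : IsMIntegralCurve (I := 𝓘(ℝ, E)) c (mulInvariantVectorField X))
    (hc' : IsMIntegralCurve (I := 𝓘(ℝ, E)) c' (mulInvariantVectorField X)) (h : c 0 = c' 0) :
    c = c' := by
  have := isManifold_one_of_lieGroup (E := E) (G := G)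
  exact isMIntegralCurve_Ioo_eq_of_contMDiff_boundaryless
    (contMDiff_one_mulInvariantVectorField X) hc hc' h

lemma lieExp_smul_eq {X : LieAlg E G} {c : ℝ → G} (hc0 : c 0 = 1)
    (hc : IsMIntegralCurve (I := 𝓘(ℝ, E)) c (mulInvariantVectorField X)) (t : ℝ) :
    lieExp (t • X) = c t := by
  have h := exists_isMIntegralCurve_mulInvariantVectorField (t • X)
  have h1 : IsMIntegralCurve (I := 𝓘(ℝ, E)) (c ∘ (· * t)) (mulInvariantVectorField (t • X)) := by
    rw [mulInvariantVectorField_smul]; exact hc.comp_mul t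
  have h2 := isMIntegralCurve_unique h.choose_spec.2 h1 (by rw [h.choose_spec.1]; simp [hc0])
  rw [lieExp, dif_pos h, h2]
  simp

lemma isMIntegralCurve_lieExp (X : LieAlg E G) :
    IsMIntegralCurve (I := 𝓘(ℝ, E)) (fun t : ℝ ↦ lieExp (t • X)) (mulInvariantVectorField X) := by
  obtain ⟨c, hc0, hc⟩ := exists_isMIntegralCurve_mulInvariantVectorField X
  rwa [funext (lieExp_smul_eq hc0 hc)]

lemma lieExp_zero_smul (X : LieAlg E G) : lieExp ((0 : ℝ) • X) = 1 := by
  obtain ⟨c, hc0, hc⟩ := exists_isMIntegralCurve_mulInvariantVectorField X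
  rw [lieExp_smul_eq hc0 hc, hc0]

lemma lieExp_add_smul (X : LieAlg E G) (s t : ℝ) :
    lieExp ((s + t) • X) = lieExp (s • X) * lieExp (t • X) := by
  have h1 := isMIntegralCurve_mul_left (isMIntegralCurve_lieExp X) (lieExp (s • X))
  have h2 := (isMIntegralCurve_lieExp X).comp_add s
  have h3 := congrFun (isMIntegralCurve_unique h2 h1 (by
    simp only [Function.comp, zero_add, lieExp_zero_smul, mul_one])) t
  rw [← h3, Function.comp, add_comm]

lemma lieExp_neg_smul (X : LieAlg E G) (t : ℝ) : lieExp ((-t) • X) = (lieExp (t • X))⁻¹ := by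
  rw [eq_inv_iff_mul_eq_one, ← lieExp_add_smul, neg_add_cancel, lieExp_zero_smul]

lemma mulInvariantVectorField_one (X : LieAlg E G) : mulInvariantVectorField X (1 : G) = X := by
  have h1 : HasMFDerivAt 𝓘(ℝ, E) 𝓘(ℝ, E) (fun b : G ↦ 1 * b) 1 (ContinuousLinearMap.id ℝ E) := by
    rw [funext (fun b : G ↦ one_mul b)]
    exact hasMFDerivAt_id (1 : G)
  exact congrArg (fun f : E →L[ℝ] E ↦ f X)
    (hasMFDerivAt_unique (hasMFDerivAt_mul_left (E := E) (1 : G) 1) h1)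

/-- One-parameter subgroups have the expected velocity at `0`. -/
lemma hasMFDerivAt_lieExp_zero (X : LieAlg E G) :
    HasMFDerivAt 𝓘(ℝ, ℝ) 𝓘(ℝ, E) (fun t : ℝ ↦ lieExp (t • X)) 0
      (ContinuousLinearMap.toSpanSingleton ℝ X : ℝ →L[ℝ] E) := by
  have h := isMIntegralCurve_lieExp X 0
  have h2 : (mulInvariantVectorField X (lieExp ((0 : ℝ) • X)) : E) = X := by
    rw [lieExp_zero_smul, mulInvariantVectorField_one]
  refine h.congr_mfderiv ?_
  rw [ContinuousLinearMap.smulRight_one_eq_toSpanSingleton]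
  exact congrArg (fun z : E ↦ ContinuousLinearMap.toSpanSingleton ℝ z) h2

/-- One-parameter groups are smooth: near `0` they solve a smooth differential equation in the chart
at `1`, and `exp (t X) = exp (t₀ X) exp ((t - t₀) X)` carries this to every `t₀`. -/
lemma contMDiff_lieExp_smul (X : LieAlg E G) :
    ContMDiff 𝓘(ℝ, ℝ) 𝓘(ℝ, E) ∞ (fun t : ℝ ↦ (lieExp (t • X) : G)) := by
  have hM : IsManifold 𝓘(ℝ, E) ∞ G := inferInstance
  have := isManifold_one_of_lieGroup (E := E) (G := G)
  set c : ℝ → G := fun t ↦ lieExp (t • X) with hcdef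
  have hc : IsMIntegralCurve (I := 𝓘(ℝ, E)) c (mulInvariantVectorField X) :=
    isMIntegralCurve_lieExp X
  set φ := extChartAt 𝓘(ℝ, E) (1 : G)
  have hSo : IsOpen (c ⁻¹' φ.source) := (isOpen_extChartAt_source (1 : G)).preimage hc.continuous
  have h0S : (0 : ℝ) ∈ c ⁻¹' φ.source := by
    simp only [Set.mem_preimage, hcdef, lieExp_zero_smul]; exact mem_extChartAt_source (1 : G)
  have hu : ∀ t ∈ c ⁻¹' φ.source, HasDerivAt (fun t ↦ φ (c t)) (chartLeft E G (φ (c t)) X) t := by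
    intro t ht
    have h1 : HasMFDerivAt 𝓘(ℝ, E) 𝓘(ℝ, E) φ (c t) (diffL φ (c t) : E →L[ℝ] E) :=
      (mdifferentiableAt_extChartAt (by simpa [φ] using ht)).hasMFDerivAt
    have h2 : HasFDerivAt (φ ∘ c) ((diffL φ (c t) : E →L[ℝ] E).comp
        ((1 : ℝ →L[ℝ] ℝ).smulRight ((diffL (fun b : G ↦ c t * b) (1 : G) : E →L[ℝ] E) X))) t :=
      hasMFDerivAt_iff_hasFDerivAt.1 (h1.comp t (hc t))
    refine h2.hasDerivAt.congr_deriv ?_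
    rw [← mfderiv_extChartAt_mul_left (φ.map_source ht), φ.left_inv ht, comp_smulRight_one]
    exact one_smul ℝ _
  have hus : ContDiffOn ℝ ∞ (fun t ↦ φ (c t)) (c ⁻¹' φ.source) :=
    contDiffOn_of_hasDerivAt_comp (v := fun x ↦ chartLeft E G x X) (T := φ.target)
      (fun x hx ↦ ((contDiffAt_chartLeft hx).clm_apply contDiffAt_const).contDiffWithinAt) hSo
      (fun t ht ↦ φ.map_source ht) hu
  have hc0 : ContMDiffAt 𝓘(ℝ, ℝ) 𝓘(ℝ, E) ∞ c 0 := by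
    have h1 : ContMDiffAt 𝓘(ℝ, ℝ) 𝓘(ℝ, E) ∞ (fun t ↦ φ.symm (φ (c t))) 0 :=
      ContMDiffAt.comp (I' := 𝓘(ℝ, E)) (0 : ℝ)
        ((contMDiffOn_extChartAt_symm (1 : G)).contMDiffAt
          ((isOpen_extChartAt_target (1 : G)).mem_nhds (φ.map_source h0S)))
        (hus.contDiffAt (hSo.mem_nhds h0S)).contMDiffAt
    refine h1.congr_of_eventuallyEq ?_
    filter_upwards [hSo.mem_nhds h0S] with t ht
    exact (φ.left_inv ht).symm
  intro t₀
  have h1 : ContMDiffAt 𝓘(ℝ, ℝ) 𝓘(ℝ, E) ∞ (fun t ↦ c (t - t₀)) t₀ := by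
    have h3 : ContDiff ℝ ∞ (fun t : ℝ ↦ t - t₀) := contDiff_id.sub contDiff_const
    exact ContMDiffAt.comp (I' := 𝓘(ℝ, ℝ)) (g := c) t₀ (by simpa using hc0)
      h3.contMDiff.contMDiffAt
  have h2 : ContMDiffAt 𝓘(ℝ, ℝ) 𝓘(ℝ, E) ∞ (fun t ↦ c t₀ * c (t - t₀)) t₀ :=
    contMDiffAt_const.mul h1
  convert h2 using 2 with t
  rw [hcdef, ← lieExp_add_smul]
  simp

end Exponential

/-! ### The adjoint action of one-parameter groups -/

section AdjointExponential

variable {E : Type*} [NormedAddCommGroup E] [NormedSpace ℝ E]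
  {G : Type*} [TopologicalSpace G] [ChartedSpace E G] [Group G] [LieGroup 𝓘(ℝ, E) ∞ G]
variable [CompleteSpace E] [T2Space G]

lemma hasDerivAt_AdL_lieExp_zero (Y : LieAlg E G) :
    HasDerivAt (fun t : ℝ ↦ (AdL (lieExp (t • Y) : G) : E →L[ℝ] E)) (adL G Y) 0 :=
  hasDerivAt_AdL_comp (lieExp_zero_smul Y) (hasMFDerivAt_lieExp_zero Y)

lemma hasDerivAt_AdL_lieExp (Y : LieAlg E G) (t : ℝ) :
    HasDerivAt (fun t : ℝ ↦ (AdL (lieExp (t • Y) : G) : E →L[ℝ] E))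
      ((AdL (lieExp (t • Y) : G) : E →L[ℝ] E).comp (adL G Y)) t := by
  have h0 := hasDerivAt_AdL_lieExp_zero Y
  have h1 : HasDerivAt (fun s : ℝ ↦ (AdL (lieExp ((s - t) • Y) : G) : E →L[ℝ] E)) (adL G Y) t := by
    have h2 : HasDerivAt (fun s : ℝ ↦ (AdL (lieExp (s • Y) : G) : E →L[ℝ] E)) (adL G Y)
        (t - t) := by
      rwa [sub_self]
    exact h2.comp_sub_const t t
  have h3 := (hasDerivAt_const t (AdL (lieExp (t • Y) : G) : E →L[ℝ] E)).clm_comp h1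
  refine (h3.congr_deriv (by simp)).congr_of_eventuallyEq (Eventually.of_forall fun s ↦ ?_)
  change AdL (lieExp (s • Y)) = (AdL (lieExp (t • Y))).comp (AdL (lieExp ((s - t) • Y)))
  rw [← AdL_mul, ← lieExp_add_smul]
  simp

/-- `Ad (exp (t Y)) = exp (t ad Y)`: the derivative of `s ↦ Ad (exp (s Y)) exp ((t - s) ad Y)`
vanishes. -/
lemma AdL_lieExp_eq_exp (Y : LieAlg E G) (t : ℝ) :
    (AdL (lieExp (t • Y) : G) : E →L[ℝ] E) = NormedSpace.exp (t • (adL G Y : E →L[ℝ] E)) := by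
  set D : E →L[ℝ] E := adL G Y with hD
  set A : ℝ → E →L[ℝ] E := fun t ↦ AdL (lieExp (t • Y) : G)
  have h1 : ∀ s, HasDerivAt (fun s ↦ A s * NormedSpace.exp ((t - s) • D)) 0 s := by
    intro s
    have h2 : HasDerivAt (fun s ↦ NormedSpace.exp ((t - s) • D))
        (-(D * NormedSpace.exp ((t - s) • D))) s := by
      have h3 := (hasDerivAt_exp_smul_const' D (t - s)).scomp s ((hasDerivAt_id s).const_sub t)
      simpa [Function.comp_def] using h3
    have h4 := (hasDerivAt_AdL_lieExp Y s).mul h2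
    refine h4.congr_deriv ?_
    change (A s * D) * _ + A s * _ = 0
    rw [mul_neg, mul_assoc, add_neg_cancel]
  have h5 := is_const_of_deriv_eq_zero (fun s ↦ (h1 s).differentiableAt) (fun s ↦ (h1 s).deriv) t 0
  simp only [sub_self, zero_smul, NormedSpace.exp_zero, mul_one, sub_zero] at h5
  have hA0 : A 0 = 1 := by
    simp only [A, lieExp_zero_smul, AdL_one]; rfl
  rw [hA0, one_mul] at h5
  exact h5

/-- The exponential of an endomorphism preserves its closed invariant subspaces. -/
lemma exp_smul_apply_mem {D : E →L[ℝ] E} {W : Submodule ℝ E} (hW : IsClosed (W : Set E))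
    (hD : ∀ w ∈ W, D w ∈ W) (t : ℝ) {w : E} (hw : w ∈ W) : NormedSpace.exp (t • D) w ∈ W := by
  have h1 := NormedSpace.exp_series_hasSum_exp' (𝕂 := ℝ) (t • D)
  have h2 := h1.mapL (ContinuousLinearMap.apply ℝ E w)
  refine hW.mem_of_tendsto h2 (Eventually.of_forall fun s ↦ W.sum_mem fun n _ ↦ ?_)
  have h3 : ∀ n : ℕ, (D ^ n) w ∈ W := by
    intro n
    induction n with
    | zero => simpa using hw
    | succ n ih => rw [pow_succ', mul_apply_eq_comp]; exact hD _ ih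
  simp only [ContinuousLinearMap.apply_apply, smul_pow, smul_apply]
  exact W.smul_mem _ (W.smul_mem _ (h3 n))

lemma exp_smul_apply_of_apply_eq_zero {D : E →L[ℝ] E} {v : E} (hv : D v = 0) (t : ℝ) :
    NormedSpace.exp (t • D) v = v := by
  have h1 : ∀ s : ℝ, HasDerivAt (fun s : ℝ ↦ NormedSpace.exp (s • D) v) 0 s := fun s ↦
    ((hasDerivAt_exp_smul_const D s).clm_apply (hasDerivAt_const s v)).congr_deriv (by simp [hv])
  have h2 := is_const_of_deriv_eq_zero (fun s ↦ (h1 s).differentiableAt) (fun s ↦ (h1 s).deriv) t 0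
  simpa using h2

/-- The exponential of a skew-symmetric endomorphism is orthogonal. -/
lemma bilin_exp_smul_apply [FiniteDimensional ℝ E] (β : E →ₗ[ℝ] E →ₗ[ℝ] ℝ) {D : E →L[ℝ] E}
    (hD : ∀ u v, β (D u) v = -β u (D v)) (t : ℝ) (u v : E) :
    β (NormedSpace.exp (t • D) u) (NormedSpace.exp (t • D) v) = β u v := by
  set b : E →L[ℝ] E →L[ℝ] ℝ := LinearMap.toContinuousBilinearMap β
  have hb : ∀ u v, b u v = β u v := fun u v ↦ rfl
  have h1 : ∀ (s : ℝ) (w : E), HasDerivAt (fun s : ℝ ↦ NormedSpace.exp (s • D) w)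
      (D (NormedSpace.exp (s • D) w)) s := fun s w ↦
    ((hasDerivAt_exp_smul_const' D s).clm_apply (hasDerivAt_const s w)).congr_deriv (by simp)
  have h2 : ∀ s : ℝ, HasDerivAt
      (fun s : ℝ ↦ b (NormedSpace.exp (s • D) u) (NormedSpace.exp (s • D) v)) 0 s := by
    intro s
    have h3 := (((hasDerivAt_const s b).clm_apply (h1 s u)).clm_apply (h1 s v))
    refine h3.congr_deriv ?_
    simp [hb, hD]
  have h4 := is_const_of_deriv_eq_zero (fun s ↦ (h2 s).differentiableAt) (fun s ↦ (h2 s).deriv) t 0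
  simpa [hb] using h4

/-- The invariance of the Killing form. -/
lemma killing_lie_left (Y U V : LieAlg E G) : killing ⁅Y, U⁆ V = -killing U ⁅Y, V⁆ := by
  rw [← lie_skew, killing, map_neg, LinearMap.neg_apply]
  exact congrArg Neg.neg (LieModule.traceForm_apply_lie_apply ℝ (LieAlg E G) (LieAlg E G) U Y V)

lemma Ad_lieExp_mem [FiniteDimensional ℝ E] {Y : LieAlg E G} {W : Submodule ℝ (LieAlg E G)}
    (h : ∀ w ∈ W, ⁅Y, w⁆ ∈ W) (t : ℝ) {w : LieAlg E G} (hw : w ∈ W) :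
    Ad (lieExp (t • Y) : G) w ∈ W := by
  let W' : Submodule ℝ E := W
  have h1 := exp_smul_apply_mem (E := E) (D := adL G Y) (W := W')
    (Submodule.closed_of_finiteDimensional (𝕜 := ℝ) (E := E) W')
    (fun w hw ↦ (congrArg (· ∈ W) (adL_apply Y (w : LieAlg E G))).mpr (h w hw)) t hw
  rw [← AdL_lieExp_eq_exp] at h1
  exact h1

lemma Ad_lieExp_eq_self {Y v : LieAlg E G} (h : ⁅Y, v⁆ = 0) (t : ℝ) :
    Ad (lieExp (t • Y) : G) v = v := by
  have h1 := exp_smul_apply_of_apply_eq_zero (E := E) (D := adL G Y) (v := v)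
    ((adL_apply Y v).trans h) t
  rw [← AdL_lieExp_eq_exp] at h1
  exact h1

lemma killing_Ad_lieExp [FiniteDimensional ℝ E] (Y U V : LieAlg E G) (t : ℝ) :
    killing (Ad (lieExp (t • Y) : G) U) (Ad (lieExp (t • Y) : G) V) = killing U V := by
  have h1 := bilin_exp_smul_apply (E := E) (killingForm ℝ (LieAlg E G)) (D := adL G Y)
    (fun u v ↦ (congrArg (fun z : LieAlg E G ↦ killing z v) (adL_apply Y u)).trans
      ((killing_lie_left Y u v).trans
        (congrArg (fun z : LieAlg E G ↦ -killing u z) (adL_apply Y v).symm))) t U V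
  rw [← AdL_lieExp_eq_exp] at h1
  exact h1

end AdjointExponential

/-! ### The metric tensor in coordinates -/

section ChartMetric

variable {F : Type*} [NormedAddCommGroup F] [NormedSpace ℝ F]
  {M : Type*} [TopologicalSpace M] [ChartedSpace F M] [IsManifold 𝓘(ℝ, F) ∞ M]

/-- The metric at `p`, as a bilinear form on the model space (to which the tangent spaces are
definitionally equal). -/
def innerL (g : RiemMetric F M) (p : M) : F →L[ℝ] F →L[ℝ] ℝ := g.inner p

lemma innerL_pos (g : RiemMetric F M) (p : M) {v : F} (hv : v ≠ 0) : 0 < innerL g p v v :=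
  g.pos p v hv

lemma innerL_symm (g : RiemMetric F M) (p : M) (u v : F) : innerL g p u v = innerL g p v u :=
  g.symm p u v

lemma isManifold_one : IsManifold 𝓘(ℝ, F) 1 M :=
  IsManifold.of_le (n := ∞) (by exact ENat.LEInfty.out)

lemma hasMFDerivAt_extChartAt_diffL {x p : M} (hp : p ∈ (extChartAt 𝓘(ℝ, F) x).source) :
    HasMFDerivAt 𝓘(ℝ, F) 𝓘(ℝ, F) (extChartAt 𝓘(ℝ, F) x) p
      (diffL (extChartAt 𝓘(ℝ, F) x) p : F →L[ℝ] F) := by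
  have := isManifold_one (F := F) (M := M)
  exact (mdifferentiableAt_extChartAt (by simpa using hp)).hasMFDerivAt

lemma hasMFDerivAt_extChartAt_symm_diffL {x : M} {y : F} (hy : y ∈ (extChartAt 𝓘(ℝ, F) x).target) :
    HasMFDerivAt 𝓘(ℝ, F) 𝓘(ℝ, F) (extChartAt 𝓘(ℝ, F) x).symm y
      (diffL (extChartAt 𝓘(ℝ, F) x).symm y : F →L[ℝ] F) :=
  (((contMDiffOn_extChartAt_symm (I := 𝓘(ℝ, F)) (n := ∞) x).contMDiffAt
    ((isOpen_extChartAt_target x).mem_nhds hy)).mdifferentiableAt (by simp)).hasMFDerivAt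

lemma diffL_extChartAt_symm_diffL {x p : M} (hp : p ∈ (extChartAt 𝓘(ℝ, F) x).source) (a : F) :
    (diffL (extChartAt 𝓘(ℝ, F) x).symm (extChartAt 𝓘(ℝ, F) x p) : F →L[ℝ] F)
      ((diffL (extChartAt 𝓘(ℝ, F) x) p : F →L[ℝ] F) a) = a := by
  have h1 := (hasMFDerivAt_extChartAt_symm_diffL ((extChartAt 𝓘(ℝ, F) x).map_source hp)).comp p
    (hasMFDerivAt_extChartAt_diffL hp)
  have h2 : HasMFDerivAt 𝓘(ℝ, F) 𝓘(ℝ, F)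
      ((extChartAt 𝓘(ℝ, F) x).symm ∘ (extChartAt 𝓘(ℝ, F) x)) p (ContinuousLinearMap.id ℝ F) := by
    refine (hasMFDerivAt_id p).congr_of_eventuallyEq ?_
    filter_upwards [(isOpen_extChartAt_source x).mem_nhds hp] with q hq
    exact (extChartAt 𝓘(ℝ, F) x).left_inv hq
  exact congrArg (fun f : F →L[ℝ] F ↦ f a) (hasMFDerivAt_unique h1 h2)

lemma diffL_extChartAt_diffL_symm {x : M} {y : F} (hy : y ∈ (extChartAt 𝓘(ℝ, F) x).target) (a : F) :
    (diffL (extChartAt 𝓘(ℝ, F) x) ((extChartAt 𝓘(ℝ, F) x).symm y) : F →L[ℝ] F)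
      ((diffL (extChartAt 𝓘(ℝ, F) x).symm y : F →L[ℝ] F) a) = a := by
  have h1 := (hasMFDerivAt_extChartAt_diffL ((extChartAt 𝓘(ℝ, F) x).map_target hy)).comp y
    (hasMFDerivAt_extChartAt_symm_diffL hy)
  have h2 : HasMFDerivAt 𝓘(ℝ, F) 𝓘(ℝ, F)
      ((extChartAt 𝓘(ℝ, F) x) ∘ (extChartAt 𝓘(ℝ, F) x).symm) y (ContinuousLinearMap.id ℝ F) := by
    refine (hasMFDerivAt_id y).congr_of_eventuallyEq ?_
    filter_upwards [(isOpen_extChartAt_target x).mem_nhds hy] with q hq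
    exact (extChartAt 𝓘(ℝ, F) x).right_inv hq
  exact congrArg (fun f : F →L[ℝ] F ↦ f a) (hasMFDerivAt_unique h1 h2)

lemma chartMetric_apply (g : RiemMetric F M) (x : M) (y u v : F) :
    chartMetric g x y u v = innerL g ((extChartAt 𝓘(ℝ, F) x).symm y)
      ((diffL (extChartAt 𝓘(ℝ, F) x).symm y : F →L[ℝ] F) u)
      ((diffL (extChartAt 𝓘(ℝ, F) x).symm y : F →L[ℝ] F) v) := rfl

lemma chartMetric_diffL (g : RiemMetric F M) {x p : M}
    (hp : p ∈ (extChartAt 𝓘(ℝ, F) x).source) (a b : F) :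
    chartMetric g x (extChartAt 𝓘(ℝ, F) x p) ((diffL (extChartAt 𝓘(ℝ, F) x) p : F →L[ℝ] F) a)
      ((diffL (extChartAt 𝓘(ℝ, F) x) p : F →L[ℝ] F) b) = innerL g p a b := by
  rw [chartMetric_apply, diffL_extChartAt_symm_diffL hp, diffL_extChartAt_symm_diffL hp,
    (extChartAt 𝓘(ℝ, F) x).left_inv hp]

lemma chartMetric_symm (g : RiemMetric F M) (x : M) (y u v : F) :
    chartMetric g x y u v = chartMetric g x y v u := by
  rw [chartMetric_apply, chartMetric_apply, innerL_symm]

lemma chartMetric_pos (g : RiemMetric F M) {x : M} {y : F}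
    (hy : y ∈ (extChartAt 𝓘(ℝ, F) x).target) {u : F} (hu : u ≠ 0) : 0 < chartMetric g x y u u := by
  rw [chartMetric_apply]
  refine innerL_pos g _ fun h ↦ hu ?_
  rw [← diffL_extChartAt_diffL_symm hy u, h, map_zero]

/-- The coordinate vector fields of a chart are smooth. -/
lemma contMDiffOn_extChartAt_symm_vector (x : M) (u : F) :
    ContMDiffOn 𝓘(ℝ, F) 𝓘(ℝ, F).tangent ∞ (fun y : F ↦
      (⟨(extChartAt 𝓘(ℝ, F) x).symm y, (diffL (extChartAt 𝓘(ℝ, F) x).symm y : F →L[ℝ] F) u⟩ :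
        TangentBundle 𝓘(ℝ, F) M)) (extChartAt 𝓘(ℝ, F) x).target := by
  have := isManifold_one (F := F) (M := M)
  set T := (extChartAt 𝓘(ℝ, F) x).target
  have hT : IsOpen T := isOpen_extChartAt_target x
  have h1 := (contMDiffOn_extChartAt_symm (I := 𝓘(ℝ, F)) (n := ∞) x).contMDiffOn_tangentMapWithin
    (m := ∞) (by simp) hT.uniqueMDiffOn
  have h2 : ContMDiff 𝓘(ℝ, F) 𝓘(ℝ, F).tangent ∞ (fun y : F ↦
      (⟨y, u⟩ : TangentBundle 𝓘(ℝ, F) F)) :=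
    (contMDiff_vectorSpace_iff_contDiff (V := fun _ ↦ u)).2 contDiff_const
  refine (h1.comp h2.contMDiffOn (s := T) (fun y hy ↦ hy)).congr fun y hy ↦ ?_
  exact congrArg (fun L : F →L[ℝ] F ↦ (⟨(extChartAt 𝓘(ℝ, F) x).symm y, L u⟩ :
    TangentBundle 𝓘(ℝ, F) M)) (mfderivWithin_of_isOpen hT hy).symm

lemma contDiffOn_chartMetric_apply (g : RiemMetric F M) (x : M) (u v : F) :
    ContDiffOn ℝ ∞ (fun y ↦ chartMetric g x y u v) (extChartAt 𝓘(ℝ, F) x).target := by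
  set T := (extChartAt 𝓘(ℝ, F) x).target
  have hT : IsOpen T := isOpen_extChartAt_target x
  have hb : ContMDiffOn 𝓘(ℝ, F) 𝓘(ℝ, F) ∞ (extChartAt 𝓘(ℝ, F) x).symm T :=
    contMDiffOn_extChartAt_symm (I := 𝓘(ℝ, F)) (n := ∞) x
  have h3 : ContMDiffOn 𝓘(ℝ, F) (𝓘(ℝ, F).prod 𝓘(ℝ)) ∞
      (fun m ↦ Bundle.TotalSpace.mk' ℝ (E := Bundle.Trivial M ℝ) ((extChartAt 𝓘(ℝ, F) x).symm m)
        (g.inner ((extChartAt 𝓘(ℝ, F) x).symm m)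
        ((diffL (extChartAt 𝓘(ℝ, F) x).symm m : F →L[ℝ] F) u)
        ((diffL (extChartAt 𝓘(ℝ, F) x).symm m : F →L[ℝ] F) v))) T := by
    apply ContMDiffOn.clm_bundle_apply₂ (F₁ := F) (F₂ := F)
    · exact g.contMDiff.comp_contMDiffOn hb
    · exact contMDiffOn_extChartAt_symm_vector x u
    · exact contMDiffOn_extChartAt_symm_vector x v
  intro y hy
  have h4 := h3 y hy
  rw [Bundle.contMDiffWithinAt_totalSpace] at h4
  exact h4.2.contDiffWithinAt

variable [FiniteDimensional ℝ F]

lemma contDiffAt_chartMetric (g : RiemMetric F M) {x : M} {y : F}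
    (hy : y ∈ (extChartAt 𝓘(ℝ, F) x).target) : ContDiffAt ℝ ∞ (chartMetric g x) y := by
  have h : ContDiffOn ℝ ∞ (chartMetric g x) (extChartAt 𝓘(ℝ, F) x).target :=
    contDiffOn_clm_apply.2 fun u ↦ contDiffOn_clm_apply.2 fun v ↦
      contDiffOn_chartMetric_apply g x u v
  exact h.contDiffAt ((isOpen_extChartAt_target x).mem_nhds hy)

end ChartMetric

/-! ### Christoffel symbols and the geodesic equation in coordinates -/

section Christoffel

variable {F : Type*} [NormedAddCommGroup F] [NormedSpace ℝ F] [FiniteDimensional ℝ F]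
  {M : Type*} [TopologicalSpace M] [ChartedSpace F M] [IsManifold 𝓘(ℝ, F) ∞ M]

lemma exists_equiv_chartMetric (g : RiemMetric F M) {x : M} {y : F}
    (hy : y ∈ (extChartAt 𝓘(ℝ, F) x).target) :
    ∃ e : F ≃L[ℝ] (F →L[ℝ] ℝ), (e : F →L[ℝ] F →L[ℝ] ℝ) = chartMetric g x y := by
  have hinj : Function.Injective (chartMetric g x y : F →ₗ[ℝ] F →L[ℝ] ℝ) := by
    rw [injective_iff_map_eq_zero]
    intro u hu
    by_contra h
    have h1 := chartMetric_pos g hy h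
    have h2 : chartMetric g x y u = 0 := hu
    simp [h2] at h1
  have hrank : Module.finrank ℝ F = Module.finrank ℝ (F →L[ℝ] ℝ) := by
    rw [← (LinearMap.toContinuousLinearMap (𝕜 := ℝ) (E := F) (F' := ℝ)).finrank_eq]
    exact Subspace.dual_finrank_eq.symm
  refine ⟨(LinearEquiv.ofInjectiveOfFinrankEq _ hinj hrank).toContinuousLinearEquiv, ?_⟩
  ext u v
  rfl

lemma chartMetric_christoffel (g : RiemMetric F M) {x : M} {y : F}
    (hy : y ∈ (extChartAt 𝓘(ℝ, F) x).target) (u v : F) :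
    chartMetric g x y (christoffel g x y u v) = christoffelFirst g x y u v := by
  obtain ⟨e, he⟩ := exists_equiv_chartMetric g hy
  rw [christoffel, ← he, ContinuousLinearMap.inverse_equiv]
  simp

lemma eq_zero_of_chartMetric_apply_eq_zero (g : RiemMetric F M) {x : M} {y : F}
    (hy : y ∈ (extChartAt 𝓘(ℝ, F) x).target) {u : F} (h : ∀ v, chartMetric g x y u v = 0) :
    u = 0 := by
  by_contra hu
  exact (chartMetric_pos g hy hu).ne' (h u)

lemma christoffelFirst_apply (g : RiemMetric F M) (x : M) (y u w : F) :
    christoffelFirst g x y u u w = fderiv ℝ (chartMetric g x) y u u w -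
      (1 / 2) * fderiv ℝ (chartMetric g x) y w u u := by
  simp [christoffelFirst]
  ring

lemma contDiffAt_christoffel (g : RiemMetric F M) {x : M} {y : F} (v : F)
    (hy : y ∈ (extChartAt 𝓘(ℝ, F) x).target) :
    ContDiffAt ℝ ∞ (fun p : F × F ↦ christoffel g x p.1 p.2 p.2) (y, v) := by
  obtain ⟨e, he⟩ := exists_equiv_chartMetric g hy
  have hm : ContDiffAt ℝ ∞ (fun p : F × F ↦ chartMetric g x p.1) (y, v) :=
    (contDiffAt_chartMetric g hy).comp (y, v) contDiffAt_fst
  have hD : ContDiffAt ℝ ∞ (fun p : F × F ↦ fderiv ℝ (chartMetric g x) p.1) (y, v) :=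
    ((contDiffAt_chartMetric g hy).fderiv_right (m := ∞) (by simp)).comp (y, v) contDiffAt_fst
  have hinv : ContDiffAt ℝ ∞ (fun p : F × F ↦ (chartMetric g x p.1).inverse) (y, v) := by
    have h1 : ContDiffAt ℝ ∞ (ContinuousLinearMap.inverse (R := ℝ) (M := F) (M₂ := F →L[ℝ] ℝ))
        (chartMetric g x y) := by
      rw [← he]; exact contDiffAt_map_inverse e
    exact ContDiffAt.comp (y, v) (f := fun p : F × F ↦ chartMetric g x p.1) h1 hm
  have h2 : ContDiffAt ℝ ∞ (fun p : F × F ↦ p.2) (y, v) := contDiffAt_snd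
  have hflip : ContDiffAt ℝ ∞
      (fun p : F × F ↦ ((fderiv ℝ (chartMetric g x) p.1).flip p.2).flip p.2) (y, v) := by
    have h3 : ContDiffAt ℝ ∞ (fun p : F × F ↦ (fderiv ℝ (chartMetric g x) p.1).flip) (y, v) :=
      (ContinuousLinearMap.flipₗᵢ ℝ F F (F →L[ℝ] ℝ)).contDiff.contDiffAt.comp (y, v) hD
    have h4 : ContDiffAt ℝ ∞
        (fun p : F × F ↦ ((fderiv ℝ (chartMetric g x) p.1).flip p.2).flip) (y, v) :=
      (ContinuousLinearMap.flipₗᵢ ℝ F F ℝ).contDiff.contDiffAt.comp (y, v) (h3.clm_apply h2)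
    exact h4.clm_apply h2
  have hDvv := (hD.clm_apply h2).clm_apply h2
  exact hinv.clm_apply (((hDvv.add hDvv).sub hflip).const_smul (1 / 2 : ℝ))

/-- Local uniqueness for the second order equation `u'' + Γ_u(u', u') = 0`. -/
lemma geodesic_equation_unique (g : RiemMetric F M) {x : M} {u₁ u₂ w₁ w₂ : ℝ → F} {t₀ : ℝ}
    (hy : u₁ t₀ ∈ (extChartAt 𝓘(ℝ, F) x).target)
    (h₁ : ∀ᶠ t in 𝓝 t₀, HasDerivAt u₁ (w₁ t) t ∧
      HasDerivAt w₁ (-christoffel g x (u₁ t) (w₁ t) (w₁ t)) t)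
    (h₂ : ∀ᶠ t in 𝓝 t₀, HasDerivAt u₂ (w₂ t) t ∧
      HasDerivAt w₂ (-christoffel g x (u₂ t) (w₂ t) (w₂ t)) t)
    (hu : u₁ t₀ = u₂ t₀) (hw : w₁ t₀ = w₂ t₀) : u₁ =ᶠ[𝓝 t₀] u₂ := by
  -- the geodesic flow, as a first order system
  set V : F × F → F × F := fun p ↦ (p.2, -christoffel g x p.1 p.2 p.2)
  have hV : ContDiffAt ℝ 1 V (u₁ t₀, w₁ t₀) :=
    (contDiffAt_snd.prodMk (contDiffAt_christoffel g (w₁ t₀) hy).neg).of_le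
      (by exact ENat.LEInfty.out)
  obtain ⟨K, s, hs, hlip⟩ := hV.exists_lipschitzOnWith
  have hc {u w : ℝ → F} (h : ∀ᶠ t in 𝓝 t₀, HasDerivAt u (w t) t ∧
      HasDerivAt w (-christoffel g x (u t) (w t) (w t)) t) (hu : u t₀ = u₁ t₀) (hw : w t₀ = w₁ t₀) :
      ∀ᶠ t in 𝓝 t₀, HasDerivAt (fun t ↦ (u t, w t)) (V (u t, w t)) t ∧ (u t, w t) ∈ s := by
    have hcont : ContinuousAt (fun t ↦ (u t, w t)) t₀ :=
      h.self_of_nhds.1.continuousAt.prodMk h.self_of_nhds.2.continuousAt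
    filter_upwards [h, hcont.eventually_mem (by simpa only [hu, hw] using hs)] with t ht hts
    exact ⟨ht.1.prodMk ht.2, hts⟩
  have h := ODE_solution_unique_of_eventually (v := fun _ ↦ V) (s := fun _ ↦ s) (K := K)
    (Eventually.of_forall fun _ ↦ hlip) (hc h₁ rfl rfl) (hc h₂ hu.symm hw.symm)
    (by simp only [hu, hw])
  exact h.mono fun t ht ↦ congrArg Prod.fst ht

/-- Noether's theorem in coordinates: if the variation `s ↦ U (s, ·)` preserves the energy density
`m(∂ₜU, ∂ₜU)` and if the momentum `m(∂ₜU, ∂ₛU)` is constant along `t ↦ U (0, t)`, then the geodesic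
equation of this curve holds in the direction of `∂ₛU`. -/
lemma noether_coordinates {m : F → F →L[ℝ] F →L[ℝ] ℝ} {U : ℝ × ℝ → F} {t₀ : ℝ}
    (hU : ContDiffAt ℝ ∞ U (0, t₀)) (hm : DifferentiableAt ℝ m (U (0, t₀)))
    (hsymm : ∀ y u v, m y u v = m y v u) {C J : ℝ}
    (hC : ∀ᶠ s in 𝓝 (0 : ℝ), m (U (s, t₀)) (fderiv ℝ U (s, t₀) (0, 1))
      (fderiv ℝ U (s, t₀) (0, 1)) = C)
    (hJ : ∀ᶠ t in 𝓝 t₀, m (U (0, t)) (fderiv ℝ U (0, t) (0, 1)) (fderiv ℝ U (0, t) (1, 0)) = J) :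
    let u : ℝ → F := fun t ↦ U (0, t)
    let u' := deriv u t₀
    let z := fderiv ℝ U (0, t₀) (1, 0)
    m (u t₀) (deriv (deriv u) t₀) z +
      (fderiv ℝ m (u t₀) u' u' z - (1 / 2) * fderiv ℝ m (u t₀) z u' u') = 0 := by
  intro u u' z
  set P := fderiv ℝ U with hPdef
  have hUd : HasFDerivAt U (P (0, t₀)) (0, t₀) := (hU.differentiableAt (by simp)).hasFDerivAt
  set P' := fderiv ℝ P (0, t₀)
  have hP : HasFDerivAt P P' (0, t₀) :=
    ((hU.fderiv_right (m := ∞) (by simp)).differentiableAt (by simp)).hasFDerivAt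
  have hsym : P' (1, 0) (0, 1) = P' (0, 1) (1, 0) :=
    (hU.isSymmSndFDerivAt (by
      rw [minSmoothness_of_isRCLikeNormedField]; exact ENat.LEInfty.out)) (1, 0) (0, 1)
  have hs : HasDerivAt (fun s : ℝ ↦ (s, t₀)) ((1, 0) : ℝ × ℝ) 0 :=
    (hasDerivAt_id (0 : ℝ)).prodMk (hasDerivAt_const (0 : ℝ) t₀)
  have ht : HasDerivAt (fun t : ℝ ↦ ((0, t) : ℝ × ℝ)) ((0, 1) : ℝ × ℝ) t₀ :=
    (hasDerivAt_const t₀ (0 : ℝ)).prodMk (hasDerivAt_id t₀)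
  have hmd : HasFDerivAt m (fderiv ℝ m (u t₀)) (U (0, t₀)) := hm.hasFDerivAt
  -- the derivative of `u` near `t₀`
  have hder : deriv u =ᶠ[𝓝 t₀] fun t ↦ P (0, t) (0, 1) := by
    have h1 : ∀ᶠ p in 𝓝 ((0, t₀) : ℝ × ℝ), DifferentiableAt ℝ U p :=
      ((hU.of_le (m := 1) (by exact ENat.LEInfty.out)).eventually (by simp)).mono
        fun p hp ↦ hp.differentiableAt (by simp)
    have h2 : ContinuousAt (fun t : ℝ ↦ ((0, t) : ℝ × ℝ)) t₀ := ht.continuousAt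
    filter_upwards [h2.eventually h1] with t htt
    have h3 : HasDerivAt (fun t : ℝ ↦ ((0, t) : ℝ × ℝ)) ((0, 1) : ℝ × ℝ) t :=
      (hasDerivAt_const t (0 : ℝ)).prodMk (hasDerivAt_id t)
    exact (htt.hasFDerivAt.comp_hasDerivAt t h3).deriv
  have hu' : u' = P (0, t₀) (0, 1) := hder.self_of_nhds
  have hPs (w : ℝ × ℝ) : HasDerivAt (fun s : ℝ ↦ P (s, t₀) w) (P' (1, 0) w) 0 :=
    ((HasFDerivAt.comp_hasDerivAt (0 : ℝ) (f := fun s : ℝ ↦ (s, t₀)) hP hs).clm_apply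
      (hasDerivAt_const (0 : ℝ) w)).congr_deriv (by simp)
  have hPt (w : ℝ × ℝ) : HasDerivAt (fun t : ℝ ↦ P (0, t) w) (P' (0, 1) w) t₀ :=
    ((HasFDerivAt.comp_hasDerivAt t₀ (f := fun t : ℝ ↦ ((0, t) : ℝ × ℝ)) hP ht).clm_apply
      (hasDerivAt_const t₀ w)).congr_deriv (by simp)
  have hu'' : deriv (deriv u) t₀ = P' (0, 1) (0, 1) := by
    rw [hder.deriv_eq]; exact (hPt (0, 1)).deriv
  have hms : HasDerivAt (fun s : ℝ ↦ m (U (s, t₀))) (fderiv ℝ m (u t₀) z) 0 :=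
    HasFDerivAt.comp_hasDerivAt (0 : ℝ) (f := fun s : ℝ ↦ U (s, t₀)) (l := m) hmd
      (HasFDerivAt.comp_hasDerivAt (0 : ℝ) (f := fun s : ℝ ↦ (s, t₀)) hUd hs)
  have hmt : HasDerivAt (fun t : ℝ ↦ m (U (0, t))) (fderiv ℝ m (u t₀) u') t₀ := by
    rw [hu']
    exact HasFDerivAt.comp_hasDerivAt t₀ (f := fun t : ℝ ↦ U (0, t)) hmd
      (HasFDerivAt.comp_hasDerivAt t₀ (f := fun t : ℝ ↦ ((0, t) : ℝ × ℝ)) hUd ht)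
  -- `e1` and `e2` differentiate the constant energy in `s` and the constant momentum in `t`; the
  -- second derivatives `∂ₛ∂ₜU` and `∂ₜ∂ₛU` they contain cancel in `e2 - e1 / 2`
  have e1 := ((hms.clm_apply (hPs (0, 1))).clm_apply (hPs (0, 1))).unique
    ((hasDerivAt_const (0 : ℝ) C).congr_of_eventuallyEq hC)
  have e2 := ((hmt.clm_apply (hPt (0, 1))).clm_apply (hPt (1, 0))).unique
    ((hasDerivAt_const t₀ J).congr_of_eventuallyEq hJ)
  simp only [← hu', add_apply] at e1 e2
  have e3 := hsymm (u t₀) (P' (1, 0) (0, 1)) u'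
  rw [hu'']
  rw [hsym] at e1 e3
  simp only [u, z] at *
  linarith

end Christoffel

/-! ### Geodesics: Noether's criterion and uniqueness -/

section Geodesic

variable {F : Type*} [NormedAddCommGroup F] [NormedSpace ℝ F]
  {M : Type*} [TopologicalSpace M] [ChartedSpace F M]

/-- The velocity of a curve, as a vector of the model space. -/
def vel (c : ℝ → M) (t : ℝ) : F := (diffL c t : ℝ →L[ℝ] F) 1

lemma hasMFDerivAt_vel {c : ℝ → M} {t : ℝ} (hc : MDifferentiableAt 𝓘(ℝ, ℝ) 𝓘(ℝ, F) c t) :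
    HasMFDerivAt 𝓘(ℝ, ℝ) 𝓘(ℝ, F) c t
      (ContinuousLinearMap.toSpanSingleton ℝ (vel c t : F) : ℝ →L[ℝ] F) := by
  refine hc.hasMFDerivAt.congr_mfderiv ?_
  change (diffL c t : ℝ →L[ℝ] F) = ContinuousLinearMap.toSpanSingleton ℝ ((diffL c t : ℝ →L[ℝ] F) 1)
  ext; simp

lemma vel_eq_of_hasMFDerivAt {c : ℝ → M} {t : ℝ} {v : F} (hc : HasMFDerivAt 𝓘(ℝ, ℝ) 𝓘(ℝ, F) c t
    (ContinuousLinearMap.toSpanSingleton ℝ v : ℝ →L[ℝ] F)) : vel c t = v := by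
  have h := hasMFDerivAt_unique hc.mdifferentiableAt.hasMFDerivAt hc
  refine (congrArg (fun f : ℝ →L[ℝ] F ↦ f 1) h).trans ?_
  simp

lemma eq_and_vel_eq_of_velocity_eq {c c' : ℝ → M} {t t' : ℝ}
    (h : (velocity c t : TangentBundle 𝓘(ℝ, F) M) = velocity c' t') :
    c t = c' t' ∧ (vel c t : F) = vel c' t' :=
  ⟨congrArg Bundle.TotalSpace.proj h, congrArg (fun z : TangentBundle 𝓘(ℝ, F) M ↦ (z.2 : F)) h⟩

variable [IsManifold 𝓘(ℝ, F) ∞ M]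

lemma hasDerivAt_extChartAt_comp_curve {c : ℝ → M} {t : ℝ} {x : M}
    (hc : MDifferentiableAt 𝓘(ℝ, ℝ) 𝓘(ℝ, F) c t) (ht : c t ∈ (extChartAt 𝓘(ℝ, F) x).source) :
    HasDerivAt (fun s ↦ extChartAt 𝓘(ℝ, F) x (c s))
      ((diffL (extChartAt 𝓘(ℝ, F) x) (c t) : F →L[ℝ] F) (vel c t)) t := by
  have h1 := (hasMFDerivAt_extChartAt_diffL ht).comp t (hasMFDerivAt_vel hc)
  have h2 : HasFDerivAt (fun s ↦ extChartAt 𝓘(ℝ, F) x (c s))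
      ((diffL (extChartAt 𝓘(ℝ, F) x) (c t) : F →L[ℝ] F).comp
        (ContinuousLinearMap.toSpanSingleton ℝ (vel c t : F) : ℝ →L[ℝ] F)) t :=
    hasMFDerivAt_iff_hasFDerivAt.1 h1
  exact h2.hasDerivAt.congr_deriv (by simp)

variable [FiniteDimensional ℝ F]

/-- Noether's theorem as a criterion: a curve `γ` is a geodesic if, at each time `t₀`, every tangent
vector `w` extends to a variation `Φ` of `γ` that preserves the energy density at `t₀` and for which
the momentum of `γ` is constant. -/
theorem isGeodesicOn_of_noether {g : RiemMetric F M} {γ : ℝ → M}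
    (hγ : ContMDiff 𝓘(ℝ, ℝ) 𝓘(ℝ, F) ∞ γ)
    (H : ∀ (t₀ : ℝ) (w : F), ∃ Φ : ℝ × ℝ → M, ContMDiff 𝓘(ℝ, ℝ × ℝ) 𝓘(ℝ, F) ∞ Φ ∧
      (∀ t, Φ (0, t) = γ t) ∧ vel (fun s ↦ Φ (s, t₀)) 0 = w ∧
      (∃ C, ∀ s, innerL g (Φ (s, t₀)) (vel (fun t ↦ Φ (s, t)) t₀) (vel (fun t ↦ Φ (s, t)) t₀) = C) ∧
      ∃ J, ∀ t, innerL g (γ t) (vel γ t) (vel (fun s ↦ Φ (s, t)) 0) = J) :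
    IsGeodesicOn g γ Set.univ := by
  refine ⟨hγ.contMDiffOn, fun x t₀ _ hx ↦ ?_⟩
  intro u
  set φ := extChartAt 𝓘(ℝ, F) x
  refine eq_zero_of_chartMetric_apply_eq_zero g (φ.map_source hx) fun v ↦ ?_
  obtain ⟨Φ, hΦ, hΦ0, hw, ⟨C, hC⟩, J, hJ⟩ :=
    H t₀ ((diffL φ.symm (φ (γ t₀)) : F →L[ℝ] F) v)
  set U : ℝ × ℝ → F := fun p ↦ φ (Φ p) with hUdef
  have hmem (p : ℝ × ℝ) (hp : Φ p ∈ φ.source) : ContDiffAt ℝ ∞ U p := by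
    have h1 : ContMDiffAt 𝓘(ℝ, F) 𝓘(ℝ, F) ∞ φ (Φ p) :=
      contMDiffAt_extChartAt' (by simpa [φ] using hp)
    exact (ContMDiffAt.comp p h1 hΦ.contMDiffAt).contDiffAt
  have hΦt (s t : ℝ) : MDifferentiableAt 𝓘(ℝ, ℝ) 𝓘(ℝ, F) (fun t ↦ Φ (s, t)) t :=
    (hΦ.comp (contDiff_const.prodMk contDiff_id :
      ContDiff ℝ ∞ fun t : ℝ ↦ (s, t)).contMDiff).mdifferentiableAt (by simp)
  have hΦs (s t : ℝ) : MDifferentiableAt 𝓘(ℝ, ℝ) 𝓘(ℝ, F) (fun s ↦ Φ (s, t)) s :=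
    (hΦ.comp (contDiff_id.prodMk contDiff_const :
      ContDiff ℝ ∞ fun s : ℝ ↦ (s, t)).contMDiff).mdifferentiableAt (by simp)
  have hUt (s t : ℝ) (hp : Φ (s, t) ∈ φ.source) : fderiv ℝ U (s, t) (0, 1) =
      (diffL φ (Φ (s, t)) : F →L[ℝ] F) (vel (fun t ↦ Φ (s, t)) t) := by
    have h1 : HasDerivAt (fun t : ℝ ↦ (s, t)) ((0, 1) : ℝ × ℝ) t :=
      (hasDerivAt_const t s).prodMk (hasDerivAt_id t)
    have h2 := ((hmem (s, t) hp).differentiableAt (by simp)).hasFDerivAt.comp_hasDerivAt t h1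
    exact h2.unique (hasDerivAt_extChartAt_comp_curve (hΦt s t) hp)
  have hUs (s t : ℝ) (hp : Φ (s, t) ∈ φ.source) : fderiv ℝ U (s, t) (1, 0) =
      (diffL φ (Φ (s, t)) : F →L[ℝ] F) (vel (fun s ↦ Φ (s, t)) s) := by
    have h1 : HasDerivAt (fun s : ℝ ↦ (s, t)) ((1, 0) : ℝ × ℝ) s :=
      (hasDerivAt_id s).prodMk (hasDerivAt_const s t)
    have h2 := ((hmem (s, t) hp).differentiableAt (by simp)).hasFDerivAt.comp_hasDerivAt
      (f := fun s : ℝ ↦ (s, t)) s h1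
    exact h2.unique (hasDerivAt_extChartAt_comp_curve (hΦs s t) hp)
  have hopen : IsOpen (Φ ⁻¹' φ.source) := (isOpen_extChartAt_source x).preimage hΦ.continuous
  have h0 : Φ (0, t₀) ∈ φ.source := by rw [hΦ0]; exact hx
  have hγvel : (fun t ↦ Φ (0, t)) = γ := funext hΦ0
  have key := noether_coordinates (m := chartMetric g x) (U := U) (t₀ := t₀) (C := C) (J := J)
    (hmem _ h0) ((contDiffAt_chartMetric g (φ.map_source h0)).differentiableAt (by simp))
    (chartMetric_symm g x) ?_ ?_
  · have hu : (fun t ↦ U (0, t)) = u := by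
      funext t; simp only [U, u, hΦ0]; rfl
    simp only [hu, hUs 0 t₀ h0, hw, hΦ0] at key
    have hinv := diffL_extChartAt_diffL_symm (φ.map_source hx) v
    rw [φ.left_inv hx] at hinv
    rw [hinv] at key
    rw [map_add, add_apply, chartMetric_christoffel g (φ.map_source hx), christoffelFirst_apply]
    have hut : U (0, t₀) = u t₀ := by rw [← hu]
    rw [hut] at key
    exact key
  · have h1 : ∀ᶠ s in 𝓝 (0 : ℝ), Φ (s, t₀) ∈ φ.source := by
      have h2 : ContinuousAt (fun s : ℝ ↦ (s, t₀)) 0 := by fun_prop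
      exact h2.eventually (hopen.mem_nhds h0)
    filter_upwards [h1] with s hs
    rw [hUt s t₀ hs, chartMetric_diffL g hs, hC]
  · have h1 : ∀ᶠ t in 𝓝 t₀, Φ (0, t) ∈ φ.source := by
      have h2 : ContinuousAt (fun t : ℝ ↦ ((0, t) : ℝ × ℝ)) t₀ := by fun_prop
      exact h2.eventually (hopen.mem_nhds h0)
    filter_upwards [h1] with t ht
    rw [hUt 0 t ht, hUs 0 t ht, chartMetric_diffL g ht, hγvel, hΦ0, hJ]

lemma eventually_geodesic_equation {g : RiemMetric F M} {c : ℝ → M} {J : Set ℝ} (hJ : IsOpen J)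
    (hc : IsGeodesicOn g c J) {t : ℝ} (ht : t ∈ J) {x : M}
    (hx : c t ∈ (extChartAt 𝓘(ℝ, F) x).source) :
    ContDiffAt ℝ ∞ (fun s ↦ extChartAt 𝓘(ℝ, F) x (c s)) t ∧
    ∀ᶠ s in 𝓝 t, HasDerivAt (fun s ↦ extChartAt 𝓘(ℝ, F) x (c s))
      (deriv (fun s ↦ extChartAt 𝓘(ℝ, F) x (c s)) s) s ∧
      HasDerivAt (deriv fun s ↦ extChartAt 𝓘(ℝ, F) x (c s))
        (-christoffel g x (extChartAt 𝓘(ℝ, F) x (c s))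
          (deriv (fun s ↦ extChartAt 𝓘(ℝ, F) x (c s)) s)
          (deriv (fun s ↦ extChartAt 𝓘(ℝ, F) x (c s)) s)) s := by
  set φ := extChartAt 𝓘(ℝ, F) x
  have hcd : ∀ s ∈ J, c s ∈ φ.source → ContDiffAt ℝ ∞ (fun s ↦ φ (c s)) s := by
    intro s hs hsx
    have h1 : ContMDiffAt 𝓘(ℝ, F) 𝓘(ℝ, F) ∞ φ (c s) :=
      contMDiffAt_extChartAt' (by simpa [φ] using hsx)
    exact (ContMDiffAt.comp s h1 ((hc.1 s hs).contMDiffAt (hJ.mem_nhds hs))).contDiffAt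
  refine ⟨hcd t ht hx, ?_⟩
  have hcont : ContinuousAt c t := ((hc.1 t ht).contMDiffAt (hJ.mem_nhds ht)).continuousAt
  filter_upwards [hJ.mem_nhds ht, hcont.eventually_mem ((isOpen_extChartAt_source x).mem_nhds hx)]
    with s hs hsx
  have h1 := hcd s hs hsx
  refine ⟨(h1.differentiableAt (by simp)).hasDerivAt, ?_⟩
  have h2 : DifferentiableAt ℝ (deriv fun s ↦ φ (c s)) s :=
    ((h1.fderiv_right (m := ∞) (by simp)).clm_apply contDiffAt_const).differentiableAt (by simp)
  refine h2.hasDerivAt.congr_deriv ?_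
  exact eq_neg_of_add_eq_zero_left (hc.2 x s hs hsx)

lemma eventuallyEq_of_isGeodesicOn {g : RiemMetric F M} {c₁ c₂ : ℝ → M} {J : Set ℝ} (hJ : IsOpen J)
    (h₁ : IsGeodesicOn g c₁ J) (h₂ : IsGeodesicOn g c₂ J) {t : ℝ} (ht : t ∈ J) {x : M}
    (hx : c₁ t ∈ (extChartAt 𝓘(ℝ, F) x).source) (hc : c₁ t = c₂ t)
    (hd : deriv (fun s ↦ extChartAt 𝓘(ℝ, F) x (c₁ s)) t =
      deriv (fun s ↦ extChartAt 𝓘(ℝ, F) x (c₂ s)) t) : c₁ =ᶠ[𝓝 t] c₂ := by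
  have hx₂ : c₂ t ∈ (extChartAt 𝓘(ℝ, F) x).source := hc ▸ hx
  have h := geodesic_equation_unique g ((extChartAt 𝓘(ℝ, F) x).map_source hx)
    (eventually_geodesic_equation hJ h₁ ht hx).2 (eventually_geodesic_equation hJ h₂ ht hx₂).2
    (by rw [hc]) hd
  have hmem {c : ℝ → M} (hc : IsGeodesicOn g c J) (hx : c t ∈ (extChartAt 𝓘(ℝ, F) x).source) :
      ∀ᶠ s in 𝓝 t, c s ∈ (extChartAt 𝓘(ℝ, F) x).source :=
    ((hc.1 t ht).contMDiffAt (hJ.mem_nhds ht)).continuousAt.eventually_mem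
      ((isOpen_extChartAt_source x).mem_nhds hx)
  filter_upwards [h, hmem h₁ hx, hmem h₂ hx₂] with s hs hs₁ hs₂
  exact (extChartAt 𝓘(ℝ, F) x).injOn hs₁ hs₂ hs

/-- Geodesics are determined by their velocity at one time. -/
theorem eqOn_of_isGeodesicOn [T2Space M] {g : RiemMetric F M} {c₁ c₂ : ℝ → M} {J : Set ℝ}
    (hJ : IsOpen J) (hJc : J.OrdConnected) (h₁ : IsGeodesicOn g c₁ J) (h₂ : IsGeodesicOn g c₂ J)
    {t₀ : ℝ} (ht₀ : t₀ ∈ J)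
    (hv : (velocity c₁ t₀ : TangentBundle 𝓘(ℝ, F) M) = velocity c₂ t₀) : Set.EqOn c₁ c₂ J := by
  have hsm {c : ℝ → M} (hc : IsGeodesicOn g c J) {t : ℝ} (ht : t ∈ J) :
      ContMDiffAt 𝓘(ℝ, ℝ) 𝓘(ℝ, F) ∞ c t := (hc.1 t ht).contMDiffAt (hJ.mem_nhds ht)
  -- the set of times near which the curves agree is open, and closed in `J`
  set S := {t | c₁ =ᶠ[𝓝 t] c₂}
  suffices hsub : J ⊆ S from fun t ht ↦ (hsub ht).self_of_nhds
  refine hJc.isPreconnected.subset_of_closure_inter_subset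
    isOpen_setOfPred_eventually_nhds ⟨t₀, ht₀, ?_⟩ ?_
  · obtain ⟨h1, h2⟩ := eq_and_vel_eq_of_velocity_eq hv
    refine eventuallyEq_of_isGeodesicOn hJ h₁ h₂ ht₀ (x := c₁ t₀) (mem_extChartAt_source _) h1 ?_
    have hd₁ := hasDerivAt_extChartAt_comp_curve (x := c₁ t₀)
      ((hsm h₁ ht₀).mdifferentiableAt (by simp)) (mem_extChartAt_source _)
    have hd₂ := hasDerivAt_extChartAt_comp_curve (x := c₁ t₀)
      ((hsm h₂ ht₀).mdifferentiableAt (by simp)) (by rw [← h1]; exact mem_extChartAt_source _)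
    rw [hd₁.deriv, hd₂.deriv, h1, h2]
  · rintro t ⟨htS, ht⟩
    have hfr : ∃ᶠ s in 𝓝 t, c₁ =ᶠ[𝓝 s] c₂ := mem_closure_iff_frequently.1 htS
    have hct : c₁ t = c₂ t := by
      by_contra hne
      have h3 := ((hsm h₁ ht).continuousAt.ne_iff_eventually_ne (hsm h₂ ht).continuousAt).1 hne
      obtain ⟨s, hs, hs'⟩ := (hfr.and_eventually h3).exists
      exact hs' hs.self_of_nhds
    have hx : c₁ t ∈ (extChartAt 𝓘(ℝ, F) (c₁ t)).source := mem_extChartAt_source _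
    have hx₂ : c₂ t ∈ (extChartAt 𝓘(ℝ, F) (c₁ t)).source := hct ▸ hx
    refine eventuallyEq_of_isGeodesicOn hJ h₁ h₂ ht hx hct ?_
    have hcd {c : ℝ → M} (hc : IsGeodesicOn g c J)
        (hx : c t ∈ (extChartAt 𝓘(ℝ, F) (c₁ t)).source) :
        ContinuousAt (deriv fun s ↦ extChartAt 𝓘(ℝ, F) (c₁ t) (c s)) t :=
      (((eventually_geodesic_equation hJ hc ht hx).1.fderiv_right (m := ∞)
        (by simp)).clm_apply contDiffAt_const).continuousAt
    by_contra hne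
    have h3 := ((hcd h₁ hx).ne_iff_eventually_ne (hcd h₂ hx₂)).1 hne
    obtain ⟨s, hs, hs'⟩ := (hfr.and_eventually h3).exists
    exact hs' (hs.fun_comp (extChartAt 𝓘(ℝ, F) (c₁ t))).deriv_eq

end Geodesic

/-! ### Submersions and homogeneous spaces -/

section Submersion

variable {E : Type*} [NormedAddCommGroup E] [NormedSpace ℝ E]
  {F : Type*} [NormedAddCommGroup F] [NormedSpace ℝ F]
  {N : Type*} [TopologicalSpace N] [ChartedSpace E N]
  {M : Type*} [TopologicalSpace M] [ChartedSpace F M]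

/-- Submersions have smooth local sections. -/
lemma exists_local_section {f : N → M} {x : N}
    (hf : Manifold.IsSubmersionAt 𝓘(ℝ, E) 𝓘(ℝ, F) ∞ f x) :
    ∃ s : M → N, ContMDiffAt 𝓘(ℝ, F) 𝓘(ℝ, E) ∞ s (f x) ∧ s (f x) = x ∧
      ∀ᶠ p in 𝓝 (f x), f (s p) = p := by
  obtain ⟨F', _, _, h⟩ := hf
  set φ := h.domChart
  set ψ := h.codChart
  set e := h.equiv
  have hw : ∀ z ∈ φ.target, ψ (f (φ.symm z)) = (e z).1 := by
    intro z hz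
    have hz' : z ∈ (φ.extend 𝓘(ℝ, E)).target := by simpa using hz
    simpa using h.writtenInCharts hz'
  have hx : x ∈ φ.source := h.mem_domChart_source
  have hfx : f x ∈ ψ.source := h.mem_codChart_source
  -- in adapted charts `f` is a coordinate projection, and `q` fills in the remaining
  -- coordinates of `x`
  set q : M → E := fun p ↦ e.symm (ψ p, (e (φ x)).2) with hq
  have hqx : q (f x) = φ x := by
    have h1 := hw (φ x) (φ.map_source hx)
    rw [φ.left_inv hx] at h1
    simp only [hq, h1, Prod.mk.eta, ContinuousLinearEquiv.symm_apply_apply]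
  have hqs : ContMDiffAt 𝓘(ℝ, F) 𝓘(ℝ, E) ∞ q (f x) := by
    have h1 : ContMDiffAt 𝓘(ℝ, F) 𝓘(ℝ, F) ∞ ψ (f x) :=
      contMDiffAt_of_mem_maximalAtlas h.codChart_mem_maximalAtlas hfx
    have h2 : ContDiff ℝ ∞ (fun z : F ↦ e.symm (z, (e (φ x)).2)) :=
      e.symm.contDiff.comp (contDiff_id.prodMk contDiff_const)
    exact h2.contMDiff.contMDiffAt.comp (f x) h1
  have hqt : φ.target ∈ 𝓝 (q (f x)) := by
    rw [hqx]; exact φ.open_target.mem_nhds (φ.map_source hx)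
  refine ⟨fun p ↦ φ.symm (q p), ?_, ?_, ?_⟩
  · exact (contMDiffAt_symm_of_mem_maximalAtlas h.domChart_mem_maximalAtlas
      (mem_of_mem_nhds hqt)).comp (f x) hqs
  · simp only [hqx, φ.left_inv hx]
  · filter_upwards [hqs.continuousAt.eventually_mem hqt, ψ.open_source.mem_nhds hfx] with p hp hpψ
    refine ψ.injOn (h.mapsto_domChart_source_codChart_source (φ.map_target hp)) hpψ ?_
    rw [hw _ hp]
    simp [hq]

lemma diffL_surjective_of_isSubmersionAt {f : N → M} {x : N}
    (hf : Manifold.IsSubmersionAt 𝓘(ℝ, E) 𝓘(ℝ, F) ∞ f x)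
    (hfd : MDifferentiableAt 𝓘(ℝ, E) 𝓘(ℝ, F) f x) :
    Function.Surjective (diffL f x : E →L[ℝ] F) := by
  obtain ⟨s, hs, hsx, hfs⟩ := exists_local_section hf
  have h1 : HasMFDerivAt 𝓘(ℝ, E) 𝓘(ℝ, F) f (s (f x)) (diffL f x : E →L[ℝ] F) := by
    rw [hsx]; exact hfd.hasMFDerivAt
  have h2 := h1.comp (f x) (hs.mdifferentiableAt (by simp)).hasMFDerivAt
  have h3 := hasMFDerivAt_unique h2 ((hasMFDerivAt_id (f x)).congr_of_eventuallyEq hfs)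
  intro v
  exact ⟨(diffL s (f x) : F →L[ℝ] E) v, congrArg (fun L : F →L[ℝ] F ↦ L v) h3⟩

end Submersion

section Homogeneous

variable {E : Type*} [NormedAddCommGroup E] [NormedSpace ℝ E]
  {G : Type*} [TopologicalSpace G] [ChartedSpace E G] [Group G] [LieGroup 𝓘(ℝ, E) ∞ G]
  {F : Type*} [NormedAddCommGroup F] [NormedSpace ℝ F]
  {K : Subgroup G} [ChartedSpace F (G ⧸ K)] [IsManifold 𝓘(ℝ, F) ∞ (G ⧸ K)]

/-- The projection `G → G ⧸ K`, as a named function. -/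
def proj (K : Subgroup G) (a : G) : G ⧸ K := (a : G ⧸ K)

lemma smul_proj (a b : G) : a • proj K b = proj K (a * b) := rfl

lemma contMDiff_proj (h : IsHomogeneousSpace E F K) :
    ContMDiff 𝓘(ℝ, E) 𝓘(ℝ, F) ∞ (proj K) := by
  have : IsManifold 𝓘(ℝ, E) ∞ G := inferInstance
  exact Manifold.IsSubmersion.contMDiff h

lemma diffL_proj_surjective (h : IsHomogeneousSpace E F K) (a : G) :
    Function.Surjective (diffL (proj K) a : E →L[ℝ] F) :=
  diffL_surjective_of_isSubmersionAt (Manifold.IsSubmersion.isSubmersionAt h a)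
    ((contMDiff_proj h).mdifferentiableAt (by simp))

/-- Translations of `G ⧸ K` are smooth: near `b K` they are `p ↦ a s(p) K`, for a local section
`s` of the projection. -/
lemma contMDiff_smul_quotient (h : IsHomogeneousSpace E F K) (a : G) :
    ContMDiff 𝓘(ℝ, F) 𝓘(ℝ, F) ∞ (fun z : G ⧸ K ↦ a • z) := by
  intro z
  obtain ⟨b, rfl⟩ := QuotientGroup.mk_surjective z
  obtain ⟨s, hs, -, hps⟩ := exists_local_section (Manifold.IsSubmersion.isSubmersionAt h b)
  have h1 : ContMDiffAt 𝓘(ℝ, F) 𝓘(ℝ, F) ∞ (fun z ↦ proj K (a * s z)) (b : G ⧸ K) :=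
    ContMDiffAt.comp (g := fun c : G ↦ proj K (a * c)) _
      ((contMDiff_proj h).comp contMDiff_mul_left).contMDiffAt hs
  refine h1.congr_of_eventuallyEq ?_
  filter_upwards [hps] with p hp
  rw [← smul_proj]
  exact congrArg (a • ·) hp.symm

lemma innerL_smul {g : RiemMetric F (G ⧸ K)} (hg : IsInvariantMetric g) (a : G) (x : G ⧸ K)
    (v w : F) : innerL g (a • x) ((diffL (fun z : G ⧸ K ↦ a • z) x : F →L[ℝ] F) v)
      ((diffL (fun z : G ⧸ K ↦ a • z) x : F →L[ℝ] F) w) = innerL g x v w :=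
  hg a x v w

end Homogeneous

/-! ### The bracket relations of a generalized Wallach space and the metric at the origin -/

section Wallach

variable {E : Type*} [NormedAddCommGroup E] [NormedSpace ℝ E] [FiniteDimensional ℝ E]
  [CompleteSpace E]
  {G : Type*} [TopologicalSpace G] [ChartedSpace E G] [Group G] [LieGroup 𝓘(ℝ, E) ∞ G] [T2Space G]
  {F : Type*} [NormedAddCommGroup F] [NormedSpace ℝ F]
  {K : Subgroup G} [ChartedSpace F (G ⧸ K)]
  {𝔪 : Fin 3 → Submodule ℝ (LieAlg E G)}

/-- `Ad(K)`-invariant subspaces are `ad(𝔨)`-invariant. -/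
lemma AdInvariant.lie_mem {W : Submodule ℝ (LieAlg E G)} (hW : AdInvariant K W)
    {X w : LieAlg E G} (hX : X ∈ subgroupLieAlg E K) (hw : w ∈ W) : ⁅X, w⁆ ∈ W := by
  induction hX using Submodule.span_induction with
  | mem X hX =>
    let W' : Submodule ℝ E := W
    have hcl : IsClosed (W' : Set E) := Submodule.closed_of_finiteDimensional W'
    have h1 : HasDerivAt (fun t : ℝ ↦ (AdL (lieExp (t • X) : G) : E →L[ℝ] E) (w : E))
        ((adL G X : E →L[ℝ] E) w) 0 :=
      ((hasDerivAt_AdL_lieExp_zero X).clm_apply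
        (hasDerivAt_const (F := E) 0 (w : E))).congr_deriv (by rw [map_zero, add_zero])
    -- `⁅X, w⁆` is a limit of difference quotients of `Ad (exp (t X)) w`, which lie in the
    -- closed subspace `W`
    have h2 : (adL G X : E →L[ℝ] E) w ∈ W' := by
      refine hcl.mem_of_tendsto h1.tendsto_slope (Eventually.of_forall fun t ↦ ?_)
      refine W'.smul_mem _ (W'.sub_mem ?_ ?_)
      · exact hW _ (hX t) _ hw
      · exact hW _ (hX 0) _ hw
    exact (congrArg (· ∈ W) (adL_apply X w)).mp h2
  | zero => rw [zero_lie]; exact W.zero_mem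
  | add X Y _ _ h1 h2 => rw [add_lie]; exact W.add_mem h1 h2
  | smul a X _ h => rw [smul_lie]; exact W.smul_mem a h

lemma killing_comm (X Y : LieAlg E G) : killing X Y = killing Y X :=
  LieModule.traceForm_comm ℝ (LieAlg E G) (LieAlg E G) X Y

lemma killing_add_left (X Y Z : LieAlg E G) : killing (X + Y) Z = killing X Z + killing Y Z := by
  rw [killing, map_add, LinearMap.add_apply]

lemma killing_sub_left (X Y Z : LieAlg E G) : killing (X - Y) Z = killing X Z - killing Y Z := by
  rw [killing, map_sub, LinearMap.sub_apply]

lemma killing_neg_left (X Z : LieAlg E G) : killing (-X) Z = -killing X Z := by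
  rw [killing, map_neg, LinearMap.neg_apply]

lemma killing_smul_left (c : ℝ) (X Z : LieAlg E G) : killing (c • X) Z = c * killing X Z := by
  rw [killing, map_smul, LinearMap.smul_apply, smul_eq_mul]

lemma killing_zero_left (Z : LieAlg E G) : killing 0 Z = 0 := by
  rw [killing, map_zero, LinearMap.zero_apply]

namespace IsGeneralizedWallach

lemma exists_decomposition (hM : IsGeneralizedWallach E F K 𝔪) (V : LieAlg E G) :
    ∃ a ∈ subgroupLieAlg E K, ∃ X : Fin 3 → LieAlg E G, (∀ i, X i ∈ 𝔪 i) ∧ V = a + ∑ i, X i := by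
  have h : V ∈ subgroupLieAlg E K ⊔ ⨆ i, 𝔪 i := by rw [hM.isCompl.sup_eq_top]; trivial
  obtain ⟨a, ha, b, hb, rfl⟩ := Submodule.mem_sup.1 h
  obtain ⟨X, hX⟩ := (Submodule.mem_iSup_iff_exists_finsupp 𝔪 b).1 hb
  refine ⟨a, ha, X, hX.1, ?_⟩
  rw [← hX.2, Finsupp.sum_fintype _ _ (fun _ ↦ rfl)]

lemma killing_sum_left (hM : IsGeneralizedWallach E F K 𝔪) {X : Fin 3 → LieAlg E G}
    (hX : ∀ i, X i ∈ 𝔪 i) {i : Fin 3} {Z : LieAlg E G} (hZ : Z ∈ 𝔪 i) :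
    killing (∑ j, X j) Z = killing (X i) Z := by
  rw [killing, map_sum, LinearMap.sum_apply]
  exact Finset.sum_eq_single i (fun j _ hj ↦ hM.pairwise_orthogonal j i hj _ (hX j) _ hZ)
    (fun h ↦ (h (Finset.mem_univ i)).elim)

/-- The Killing form of the semisimple algebra `𝔤` is nondegenerate. -/
lemma eq_zero_of_orthogonal (hM : IsGeneralizedWallach E F K 𝔪) {V : LieAlg E G}
    (h0 : ∀ Z ∈ subgroupLieAlg E K, killing V Z = 0)
    (h1 : ∀ i, ∀ Z ∈ 𝔪 i, killing V Z = 0) : V = 0 := by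
  have : LieAlgebra.IsSemisimple ℝ (LieAlg E G) := hM.semisimple
  have : Module.Finite ℝ (LieAlg E G) := inferInstanceAs (FiniteDimensional ℝ E)
  refine (LieAlgebra.IsKilling.killingForm_nondegenerate ℝ (LieAlg E G)).1 V fun Z ↦ ?_
  obtain ⟨a, ha, X, hX, rfl⟩ := hM.exists_decomposition Z
  refine (killing_comm V _).trans ?_
  rw [killing_add_left, killing_comm, h0 a ha, zero_add, killing, map_sum, LinearMap.sum_apply]
  exact Finset.sum_eq_zero fun i _ ↦ (killing_comm (X i) V).trans (h1 i _ (hX i))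

/-- `𝔪 k` is the orthogonal complement of the sum of the other three summands. -/
lemma mem_of_orthogonal (hM : IsGeneralizedWallach E F K 𝔪) {k : Fin 3} {V : LieAlg E G}
    (h0 : ∀ Z ∈ subgroupLieAlg E K, killing V Z = 0)
    (h1 : ∀ i, i ≠ k → ∀ Z ∈ 𝔪 i, killing V Z = 0) : V ∈ 𝔪 k := by
  obtain ⟨a, ha, X, hX, hV⟩ := hM.exists_decomposition V
  have h2 : V - X k = 0 := by
    refine hM.eq_zero_of_orthogonal (fun Z hZ ↦ ?_) (fun i Z hZ ↦ ?_)
    · rw [killing_sub_left, h0 Z hZ, killing_comm,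
        hM.orthogonal k Z hZ _ (hX k), sub_zero]
    · rw [killing_sub_left]
      by_cases hi : i = k
      · subst hi
        rw [hV, killing_add_left, hM.orthogonal i a ha Z hZ, zero_add,
          hM.killing_sum_left hX hZ, sub_self]
      · rw [h1 i hi Z hZ, hM.pairwise_orthogonal k i (Ne.symm hi) _ (hX k) _ hZ, sub_zero]
  rw [sub_eq_zero.1 h2]
  exact hX k

/-- `[𝔪 i, 𝔪 j] ⊆ 𝔪 k` when `i, j, k` are distinct. -/
lemma lie_mem (hM : IsGeneralizedWallach E F K 𝔪) {i j k : Fin 3} (hij : i ≠ j) (hik : i ≠ k)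
    (hjk : j ≠ k) {P Q : LieAlg E G} (hP : P ∈ 𝔪 i) (hQ : Q ∈ 𝔪 j) : ⁅P, Q⁆ ∈ 𝔪 k := by
  refine hM.mem_of_orthogonal (fun Z hZ ↦ ?_) (fun l hl Z hZ ↦ ?_)
  · rw [killing_lie_left, ← lie_skew, killing, map_neg, neg_neg]
    exact hM.pairwise_orthogonal j i hij.symm _ hQ _ ((hM.irreducible i).1.lie_mem hZ hP)
  · have hl' : l = i ∨ l = j := by omega
    rcases hl' with rfl | rfl
    · rw [killing_lie_left, killing_comm, hM.orthogonal j _ (hM.bracket l _ hP _ hZ) _ hQ, neg_zero]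
    · rw [← lie_skew, killing_neg_left, killing_lie_left, neg_neg, killing_comm,
        hM.orthogonal i _ (hM.bracket l _ hQ _ hZ) _ hP]

/-- The sum of the two summands other than `𝔪 i` is `ad(𝔪 i)`-invariant. -/
lemma lie_mem_iSup (hM : IsGeneralizedWallach E F K 𝔪) {i : Fin 3} {P Q : LieAlg E G}
    (hP : P ∈ 𝔪 i) (hQ : Q ∈ ⨆ j, ⨆ (_ : j ≠ i), 𝔪 j) : ⁅P, Q⁆ ∈ ⨆ j, ⨆ (_ : j ≠ i), 𝔪 j := by
  induction hQ using Submodule.iSup_induction' with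
  | mem j Q hQ =>
    by_cases hj : j = i
    · have hQ0 : Q = 0 := by simpa [hj] using hQ
      rw [hQ0, lie_zero]; exact Submodule.zero_mem _
    · obtain ⟨k, hki, hkj⟩ : ∃ k : Fin 3, i ≠ k ∧ j ≠ k := by
        clear hQ hP
        revert i j; decide
      have hQ' : Q ∈ 𝔪 j := by simpa [hj] using hQ
      exact Submodule.mem_iSup_of_mem k (Submodule.mem_iSup_of_mem hki.symm
        (hM.lie_mem (Ne.symm hj) hki hkj hP hQ'))
  | zero => rw [lie_zero]; exact Submodule.zero_mem _
  | add Q Q' _ _ h h' => rw [lie_add]; exact Submodule.add_mem _ h h'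

end IsGeneralizedWallach

section Metric

variable [IsManifold 𝓘(ℝ, F) ∞ (G ⧸ K)]

lemma proj_of_mem {a : G} (ha : a ∈ K) : proj K a = origin K :=
  QuotientGroup.eq.2 (by simpa using ha)

/-- `dπ_e` vanishes on `𝔨`. -/
lemma diffL_proj_eq_zero (h : IsHomogeneousSpace E F K) {X : LieAlg E G}
    (hX : X ∈ subgroupLieAlg E K) : (diffL (proj K) (1 : G) : E →L[ℝ] F) X = 0 := by
  suffices h1 : subgroupLieAlg E K ≤
      (LinearMap.ker (diffL (proj K) (1 : G) : E →L[ℝ] F).toLinearMap : Submodule ℝ E) from h1 hX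
  refine Submodule.span_le.2 fun X hX ↦ ?_
  have h1 : HasMFDerivAt 𝓘(ℝ, E) 𝓘(ℝ, F) (proj K) (lieExp ((0 : ℝ) • X) : G)
      (diffL (proj K) (1 : G) : E →L[ℝ] F) := by
    rw [lieExp_zero_smul]
    exact ((contMDiff_proj h).mdifferentiableAt (by simp)).hasMFDerivAt
  have h2 := h1.comp (0 : ℝ) (hasMFDerivAt_lieExp_zero X)
  have h3 : proj K ∘ (fun t : ℝ ↦ (lieExp (t • X) : G)) = fun _ ↦ origin K :=
    funext fun t ↦ proj_of_mem (hX t)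
  rw [h3] at h2
  have h4 := hasMFDerivAt_unique h2 (hasMFDerivAt_const (origin K) (0 : ℝ))
  have h5 := congrArg (fun L : ℝ →L[ℝ] F ↦ L 1) h4
  have h6 : (diffL (proj K) (1 : G) : E →L[ℝ] F) ((1 : ℝ) • (X : E)) = 0 := h5
  rw [one_smul] at h6
  exact h6

variable {g : RiemMetric F (G ⧸ K)} {l : Fin 3 → ℝ}

/-- The metric at the origin paired with an arbitrary `V ∈ 𝔤`: the components of `V` in `𝔨` and in
the other summands do not contribute on either side. -/
lemma innerL_dproj_of_mem (hM : IsGeneralizedWallach E F K 𝔪) (hg : IsDiagonalMetric 𝔪 g l)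
    {i : Fin 3} {U : LieAlg E G} (hU : U ∈ 𝔪 i) (V : LieAlg E G) :
    innerL g (origin K) ((diffL (proj K) (1 : G) : E →L[ℝ] F) U)
      ((diffL (proj K) (1 : G) : E →L[ℝ] F) V) = -(l i * killing U V) := by
  obtain ⟨a, ha, X, hX, rfl⟩ := hM.exists_decomposition V
  have h1 : (diffL (proj K) (1 : G) : E →L[ℝ] F) ((a + ∑ i, X i : LieAlg E G) : E) =
      (diffL (proj K) (1 : G) : E →L[ℝ] F) ((X 0 + X 1 + X 2 : LieAlg E G) : E) := by
    have h2 := map_add (diffL (proj K) (1 : G) : E →L[ℝ] F) (a : E) ((∑ i, X i : LieAlg E G) : E)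
    refine (h2.trans (congrArg (· + _) (diffL_proj_eq_zero hM.homogeneous ha))).trans ?_
    rw [Fin.sum_univ_three]
    exact zero_add _
  have h3 : U = Pi.single (M := fun _ : Fin 3 ↦ LieAlg E G) i U 0 +
      Pi.single (M := fun _ : Fin 3 ↦ LieAlg E G) i U 1 +
      Pi.single (M := fun _ : Fin 3 ↦ LieAlg E G) i U 2 := by
    fin_cases i <;> simp
  have h4 := hg.inner_eq (Pi.single i U) X (fun j ↦ by
    by_cases hj : j = i
    · subst hj; simpa using hU
    · simp [hj]) hX
  rw [← h3] at h4
  have h5 : killing U (a + ∑ i, X i) = killing U (X i) := by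
    rw [killing_comm, killing_add_left, hM.orthogonal i a ha U hU, zero_add,
      hM.killing_sum_left hX hU, killing_comm]
  rw [h1, h5]
  refine Eq.trans h4 ?_
  fin_cases i <;> simp [killing_zero_left]

/-- The momentum of the velocity `P + Q`, when the metric is `r (-B)` on the sum of the summands
other than `𝔪 i` and `r c (-B)` on `𝔪 i`. -/
lemma innerL_dproj_add (hM : IsGeneralizedWallach E F K 𝔪) (hg : IsDiagonalMetric 𝔪 g l)
    {i : Fin 3} {r c : ℝ} (hi : l i = r * c) (hj : ∀ j, j ≠ i → l j = r) {P Q : LieAlg E G}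
    (hP : P ∈ 𝔪 i) (hQ : Q ∈ ⨆ j, ⨆ (_ : j ≠ i), 𝔪 j) (V : LieAlg E G) :
    innerL g (origin K) ((diffL (proj K) (1 : G) : E →L[ℝ] F) ((Q + P : LieAlg E G) : E))
      ((diffL (proj K) (1 : G) : E →L[ℝ] F) V) = -(r * killing (Q + c • P) V) := by
  let β : LieAlg E G →ₗ[ℝ] ℝ :=
    ((innerL g (origin K)).flip ((diffL (proj K) (1 : G) : E →L[ℝ] F) V)).toLinearMap.comp
      (diffL (proj K) (1 : G) : E →L[ℝ] F).toLinearMap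
  have hβP : β P = -(r * c * killing P V) := hi ▸ innerL_dproj_of_mem hM hg hP V
  have hβQ : β Q = -(r * killing Q V) := by
    induction hQ using Submodule.iSup_induction' with
    | mem j Q hQ =>
      by_cases hji : j = i
      · have hQ0 : Q = 0 := by simpa [hji] using hQ
        simp [hQ0, killing_zero_left]
      · rw [← hj j hji]
        exact innerL_dproj_of_mem hM hg (by simpa [hji] using hQ) V
    | zero => simp [killing_zero_left]
    | add Q Q' _ _ h h' => rw [map_add, h, h', killing_add_left]; ring
  refine (map_add β Q P).trans ?_
  rw [hβP, hβQ, killing_add_left, killing_smul_left]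
  ring

end Metric

end Wallach

/-! ### Velocities of products of one-parameter groups -/

section Curves

variable {E : Type*} [NormedAddCommGroup E] [NormedSpace ℝ E]
  {G : Type*} [TopologicalSpace G] [ChartedSpace E G] [Group G] [LieGroup 𝓘(ℝ, E) ∞ G]

/-- The product rule for curves through the identity. -/
lemma hasMFDerivAt_mul_curves {c d : ℝ → G} {X Y : E} (hc0 : c 0 = 1) (hd0 : d 0 = 1)
    (hc : HasMFDerivAt 𝓘(ℝ, ℝ) 𝓘(ℝ, E) c 0 (ContinuousLinearMap.toSpanSingleton ℝ X : ℝ →L[ℝ] E))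
    (hd : HasMFDerivAt 𝓘(ℝ, ℝ) 𝓘(ℝ, E) d 0
      (ContinuousLinearMap.toSpanSingleton ℝ Y : ℝ →L[ℝ] E)) :
    HasMFDerivAt 𝓘(ℝ, ℝ) 𝓘(ℝ, E) (fun t ↦ c t * d t) 0
      (ContinuousLinearMap.toSpanSingleton ℝ (X + Y) : ℝ →L[ℝ] E) := by
  set D : E × E →L[ℝ] E :=
    mfderiv (𝓘(ℝ, E).prod 𝓘(ℝ, E)) 𝓘(ℝ, E) (fun p : G × G ↦ p.1 * p.2) (1, 1) with hDdef
  have hD : HasMFDerivAt (𝓘(ℝ, E).prod 𝓘(ℝ, E)) 𝓘(ℝ, E) (fun p : G × G ↦ p.1 * p.2) (1, 1) D :=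
    ((contMDiff_mul 𝓘(ℝ, E) ∞ (G := G)).mdifferentiableAt (by simp)).hasMFDerivAt
  have hleft : D.comp (ContinuousLinearMap.inl ℝ E E) = ContinuousLinearMap.id ℝ E := by
    have h1 : HasMFDerivAt 𝓘(ℝ, E) (𝓘(ℝ, E).prod 𝓘(ℝ, E)) (fun a : G ↦ (a, (1 : G))) 1
        (ContinuousLinearMap.inl ℝ E E) :=
      (hasMFDerivAt_id (1 : G)).prodMk (hasMFDerivAt_const (1 : G) (1 : G))
    have h2 := HasMFDerivAt.comp (g := fun p : G × G ↦ p.1 * p.2)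
      (f := fun a : G ↦ (a, (1 : G))) (1 : G) hD h1
    have h3 : (fun p : G × G ↦ p.1 * p.2) ∘ (fun a : G ↦ (a, (1 : G))) = id := by
      ext; simp
    rw [h3] at h2
    exact hasMFDerivAt_unique h2 (hasMFDerivAt_id (1 : G))
  have hright : D.comp (ContinuousLinearMap.inr ℝ E E) = ContinuousLinearMap.id ℝ E := by
    have h1 : HasMFDerivAt 𝓘(ℝ, E) (𝓘(ℝ, E).prod 𝓘(ℝ, E)) (fun a : G ↦ ((1 : G), a)) 1
        (ContinuousLinearMap.inr ℝ E E) :=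
      (hasMFDerivAt_const (1 : G) (1 : G)).prodMk (hasMFDerivAt_id (1 : G))
    have h2 := HasMFDerivAt.comp (g := fun p : G × G ↦ p.1 * p.2)
      (f := fun a : G ↦ ((1 : G), a)) (1 : G) hD h1
    have h3 : (fun p : G × G ↦ p.1 * p.2) ∘ (fun a : G ↦ ((1 : G), a)) = id := by
      ext; simp
    rw [h3] at h2
    exact hasMFDerivAt_unique h2 (hasMFDerivAt_id (1 : G))
  have hD' : HasMFDerivAt (𝓘(ℝ, E).prod 𝓘(ℝ, E)) 𝓘(ℝ, E) (fun p : G × G ↦ p.1 * p.2)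
      (c 0, d 0) D := by
    rw [hc0, hd0]; exact hD
  have h := HasMFDerivAt.comp (g := fun p : G × G ↦ p.1 * p.2) (0 : ℝ) hD' (hc.prodMk hd)
  refine h.congr_mfderiv ?_
  change D.comp ((ContinuousLinearMap.toSpanSingleton ℝ X).prod
    (ContinuousLinearMap.toSpanSingleton ℝ Y)) = ContinuousLinearMap.toSpanSingleton ℝ (X + Y)
  ext
  have h4 : D (X, Y) = D (X, 0) + D (0, Y) := by rw [← map_add]; simp
  have h5 : D (X, 0) = X := congrArg (fun L : E →L[ℝ] E ↦ L X) hleft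
  have h6 : D (0, Y) = Y := congrArg (fun L : E →L[ℝ] E ↦ L Y) hright
  simpa [h5, h6] using h4

lemma hasMFDerivAt_conj_curve {c : ℝ → G} {X : E} (hc0 : c 0 = 1) (b : G)
    (hc : HasMFDerivAt 𝓘(ℝ, ℝ) 𝓘(ℝ, E) c 0
      (ContinuousLinearMap.toSpanSingleton ℝ X : ℝ →L[ℝ] E)) :
    HasMFDerivAt 𝓘(ℝ, ℝ) 𝓘(ℝ, E) (fun t ↦ b * c t * b⁻¹) 0
      (ContinuousLinearMap.toSpanSingleton ℝ ((AdL b : E →L[ℝ] E) X) : ℝ →L[ℝ] E) := by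
  have h1 : HasMFDerivAt 𝓘(ℝ, E) 𝓘(ℝ, E) (fun h : G ↦ b * h * b⁻¹) (c 0) (AdL b : E →L[ℝ] E) :=
    hasMFDerivAt_congr_point hc0.symm (hasMFDerivAt_conj b)
  refine (h1.comp (0 : ℝ) hc).congr_mfderiv ?_
  change (AdL b : E →L[ℝ] E).comp (ContinuousLinearMap.toSpanSingleton ℝ X) = _
  ext; simp

variable {F : Type*} [NormedAddCommGroup F] [NormedSpace ℝ F]
  {K : Subgroup G} [ChartedSpace F (G ⧸ K)] [IsManifold 𝓘(ℝ, F) ∞ (G ⧸ K)]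

/-- The differential of the translation of `G ⧸ K` by `a`, at the origin. -/
def originTranslation (F : Type*) [NormedAddCommGroup F] [NormedSpace ℝ F] (K : Subgroup G)
    [ChartedSpace F (G ⧸ K)] (a : G) : F →L[ℝ] F :=
  diffL (fun z : G ⧸ K ↦ a • z) (origin K)

lemma hasMFDerivAt_smul (h : IsHomogeneousSpace E F K) (a : G) (x : G ⧸ K) :
    HasMFDerivAt 𝓘(ℝ, F) 𝓘(ℝ, F) (fun z : G ⧸ K ↦ a • z) x
      (diffL (fun z : G ⧸ K ↦ a • z) x : F →L[ℝ] F) :=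
  ((contMDiff_smul_quotient h a).mdifferentiableAt (by simp)).hasMFDerivAt

lemma hasMFDerivAt_proj_mul_curve (h : IsHomogeneousSpace E F K) (a : G) {c : ℝ → G} {X : E}
    (hc0 : c 0 = 1) (hc : HasMFDerivAt 𝓘(ℝ, ℝ) 𝓘(ℝ, E) c 0
      (ContinuousLinearMap.toSpanSingleton ℝ X : ℝ →L[ℝ] E)) :
    HasMFDerivAt 𝓘(ℝ, ℝ) 𝓘(ℝ, F) (fun t ↦ proj K (a * c t)) 0
      (ContinuousLinearMap.toSpanSingleton ℝ (originTranslation F K a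
        ((diffL (proj K) (1 : G) : E →L[ℝ] F) X)) : ℝ →L[ℝ] F) := by
  have h1 : HasMFDerivAt 𝓘(ℝ, E) 𝓘(ℝ, F) (proj K) (c 0)
      (diffL (proj K) (1 : G) : E →L[ℝ] F) := by
    rw [hc0]
    exact ((contMDiff_proj h).mdifferentiableAt (by simp)).hasMFDerivAt
  have h2 : HasMFDerivAt 𝓘(ℝ, F) 𝓘(ℝ, F) (fun z : G ⧸ K ↦ a • z) ((proj K ∘ c) 0)
      (originTranslation F K a) := by
    have h3 : (proj K ∘ c) 0 = origin K := by rw [Function.comp, hc0]; rfl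
    rw [h3]
    exact hasMFDerivAt_smul h a (origin K)
  refine (h2.comp (0 : ℝ) (h1.comp (0 : ℝ) hc)).congr_mfderiv ?_
  change (originTranslation F K a).comp ((diffL (proj K) (1 : G) : E →L[ℝ] F).comp
    (ContinuousLinearMap.toSpanSingleton ℝ X)) = _
  ext; simp

lemma vel_smul (h : IsHomogeneousSpace E F K) (a : G) {c : ℝ → G ⧸ K} {t : ℝ}
    (hc : MDifferentiableAt 𝓘(ℝ, ℝ) 𝓘(ℝ, F) c t) :
    vel (fun t ↦ a • c t) t = (diffL (fun z : G ⧸ K ↦ a • z) (c t) : F →L[ℝ] F) (vel c t) := by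
  refine vel_eq_of_hasMFDerivAt
    (((hasMFDerivAt_smul h a (c t)).comp t (hasMFDerivAt_vel hc)).congr_mfderiv ?_)
  change (diffL (fun z : G ⧸ K ↦ a • z) (c t) : F →L[ℝ] F).comp
    (ContinuousLinearMap.toSpanSingleton ℝ (vel c t)) = _
  ext; simp

variable [CompleteSpace E] [T2Space G]

/-- The velocity of `t ↦ exp (t X) exp (t Y) · o`, translated back to the origin. -/
lemma vel_twoExpCurve (h : IsHomogeneousSpace E F K) (X Y : LieAlg E G) (t : ℝ) :
    vel (twoExpCurve K X Y) t = originTranslation F K (lieExp (t • X) * lieExp (t • Y))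
      ((diffL (proj K) (1 : G) : E →L[ℝ] F) (Ad (lieExp ((-t) • Y)) (X + Y))) := by
  set c : ℝ → G := fun s ↦ lieExp ((-t) • Y) * (lieExp (s • X) * lieExp (s • Y)) *
    (lieExp ((-t) • Y))⁻¹ with hcdef
  have hc0 : c 0 = 1 := by simp only [hcdef, lieExp_zero_smul, mul_one, mul_inv_cancel]
  have hc := hasMFDerivAt_conj_curve (by simp only [lieExp_zero_smul, mul_one])
    (lieExp ((-t) • Y) : G)
    (hasMFDerivAt_mul_curves (lieExp_zero_smul X) (lieExp_zero_smul Y) (hasMFDerivAt_lieExp_zero X)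
      (hasMFDerivAt_lieExp_zero Y))
  have h1 := hasMFDerivAt_proj_mul_curve h (lieExp (t • X) * lieExp (t • Y)) hc0 hc
  have h2 : HasMFDerivAt 𝓘(ℝ, ℝ) 𝓘(ℝ, ℝ) (fun s : ℝ ↦ s - t) t (ContinuousLinearMap.id ℝ ℝ) :=
    hasMFDerivAt_iff_hasFDerivAt.2 ((hasFDerivAt_id t).sub_const t)
  rw [← sub_self t] at h1
  refine vel_eq_of_hasMFDerivAt ?_
  refine ((HasMFDerivAt.comp (f := fun s : ℝ ↦ s - t) t h1 h2).congr_mfderiv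
    ?_).congr_of_eventuallyEq (Eventually.of_forall fun s ↦ ?_)
  · exact ContinuousLinearMap.comp_id _
  · have h3 : lieExp (s • X) = lieExp (t • X) * lieExp ((s - t) • X) := by
      rw [← lieExp_add_smul]; simp
    have h4 : lieExp (s • Y) = lieExp ((s - t) • Y) * lieExp (t • Y) := by
      rw [← lieExp_add_smul]; simp
    change proj K ((lieExp (s • X) * lieExp (s • Y)) * 1) = proj K _
    congr 1
    simp only [hcdef]
    rw [h3, h4, lieExp_neg_smul]
    group

/-- The derivative of the variation of `b · o` by the one-parameter group of `Z`. -/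
lemma vel_lieExp_smul (h : IsHomogeneousSpace E F K) (Z : LieAlg E G) (b : G) :
    vel (fun s : ℝ ↦ (lieExp (s • Z) * b) • origin K) 0 = originTranslation F K b
      ((diffL (proj K) (1 : G) : E →L[ℝ] F) (Ad b⁻¹ Z)) := by
  have hc := hasMFDerivAt_conj_curve (lieExp_zero_smul Z) b⁻¹ (hasMFDerivAt_lieExp_zero Z)
  have h1 := hasMFDerivAt_proj_mul_curve h b
    (by simp only [lieExp_zero_smul, mul_one, mul_inv_cancel]) hc
  refine vel_eq_of_hasMFDerivAt (h1.congr_of_eventuallyEq (Eventually.of_forall fun s ↦ ?_))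
  change proj K ((lieExp (s • Z) * b) * 1) = proj K _
  congr 1
  group

/-- The action fields of `𝔤` span the tangent spaces of `G ⧸ K`. -/
lemma exists_vel_lieExp_smul_eq (h : IsHomogeneousSpace E F K) (b : G) (w : F) :
    ∃ Z : LieAlg E G, vel (fun s : ℝ ↦ (lieExp (s • Z) * b) • origin K) 0 = w := by
  have h1 : Function.Surjective (originTranslation F K b) := by
    have h2 : HasMFDerivAt 𝓘(ℝ, F) 𝓘(ℝ, F) (fun z : G ⧸ K ↦ b • z) (b⁻¹ • b • origin K)
        (originTranslation F K b) := by
      rw [inv_smul_smul]; exact hasMFDerivAt_smul h b (origin K)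
    have h3 := h2.comp (b • origin K) (hasMFDerivAt_smul h b⁻¹ (b • origin K))
    have h4 : (fun z : G ⧸ K ↦ b • z) ∘ (fun z ↦ b⁻¹ • z) = id := by ext; simp
    rw [h4] at h3
    have h5 := hasMFDerivAt_unique h3 (hasMFDerivAt_id (b • origin K))
    exact fun v ↦ ⟨_, congrArg (fun L : F →L[ℝ] F ↦ L v) h5⟩
  obtain ⟨v, rfl⟩ := h1 w
  obtain ⟨X, rfl⟩ := diffL_proj_surjective h 1 v
  refine ⟨Ad b X, (vel_lieExp_smul h _ b).trans ?_⟩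
  have h6 : (AdL b⁻¹ : E →L[ℝ] E) ((AdL b : E →L[ℝ] E) X) = X := by
    have h7 := AdL_mul (E := E) b⁻¹ b
    rw [inv_mul_cancel, AdL_one] at h7
    exact (congrArg (fun L : E →L[ℝ] E ↦ L X) h7).symm
  exact congrArg (fun z : E ↦ originTranslation F K b ((diffL (proj K) (1 : G) : E →L[ℝ] F) z)) h6

end Curves

/-! ### The geodesics of the diagonal metrics -/

section Main

variable {E : Type*} [NormedAddCommGroup E] [NormedSpace ℝ E] [FiniteDimensional ℝ E]
  [CompleteSpace E]
  {G : Type*} [TopologicalSpace G] [ChartedSpace E G] [Group G] [LieGroup 𝓘(ℝ, E) ∞ G] [T2Space G]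
  {F : Type*} [NormedAddCommGroup F] [NormedSpace ℝ F]
  {K : Subgroup G} [ChartedSpace F (G ⧸ K)] [IsManifold 𝓘(ℝ, F) ∞ (G ⧸ K)]

lemma contMDiff_lieExp_smul_twoExpCurve (h : IsHomogeneousSpace E F K) (X Y Z : LieAlg E G) :
    ContMDiff 𝓘(ℝ, ℝ × ℝ) 𝓘(ℝ, F) ∞
      (fun p : ℝ × ℝ ↦ (lieExp (p.1 • Z) : G) • twoExpCurve K X Y p.2) := by
  have h1 : ContMDiff 𝓘(ℝ, ℝ × ℝ) 𝓘(ℝ, E) ∞ (fun p : ℝ × ℝ ↦ (lieExp (p.1 • Z) : G)) :=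
    (contMDiff_lieExp_smul Z).comp contDiff_fst.contMDiff
  have h2 (X : LieAlg E G) :
      ContMDiff 𝓘(ℝ, ℝ × ℝ) 𝓘(ℝ, E) ∞ (fun p : ℝ × ℝ ↦ (lieExp (p.2 • X) : G)) :=
    (contMDiff_lieExp_smul X).comp contDiff_snd.contMDiff
  -- the factor `1` comes from `a • origin K = proj K (a * 1)`
  exact (contMDiff_proj h).comp
    (h1.mul (((h2 X).mul (h2 Y)).mul (contMDiff_const (c := (1 : G)))))

lemma contMDiff_twoExpCurve (h : IsHomogeneousSpace E F K) (X Y : LieAlg E G) :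
    ContMDiff 𝓘(ℝ, ℝ) 𝓘(ℝ, F) ∞ (twoExpCurve K X Y) :=
  (contMDiff_proj h).comp
    (((contMDiff_lieExp_smul X).mul (contMDiff_lieExp_smul Y)).mul (contMDiff_const (c := (1 : G))))

variable [FiniteDimensional ℝ F]
  {𝔪 : Fin 3 → Submodule ℝ (LieAlg E G)} {g : RiemMetric F (G ⧸ K)} {l : Fin 3 → ℝ}

/-- The curve is a geodesic because its momentum along the action field of every `Z` is the
constant `-r B(Q + c P, Z)`. -/
theorem isGeodesicOn_twoExpCurve (hM : IsGeneralizedWallach E F K 𝔪)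
    (hg : IsDiagonalMetric 𝔪 g l) {i : Fin 3} {r c : ℝ} (hi : l i = r * c)
    (hj : ∀ j, j ≠ i → l j = r) {P Q : LieAlg E G} (hP : P ∈ 𝔪 i)
    (hQ : Q ∈ ⨆ j, ⨆ (_ : j ≠ i), 𝔪 j) :
    IsGeodesicOn g (twoExpCurve K (Q + c • P) ((1 - c) • P)) Set.univ := by
  set X : LieAlg E G := Q + c • P with hX
  set Y : LieAlg E G := (1 - c) • P with hY
  have h := hM.homogeneous
  have hγ := contMDiff_twoExpCurve (F := F) (K := K) h X Y
  refine isGeodesicOn_of_noether hγ fun t₀ w ↦ ?_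
  obtain ⟨Z, hZ⟩ := exists_vel_lieExp_smul_eq (K := K) h
    (lieExp (t₀ • X) * lieExp (t₀ • Y)) w
  have hassoc (s t : ℝ) : (lieExp (s • Z) : G) • twoExpCurve K X Y t =
      (lieExp (s • Z) * (lieExp (t • X) * lieExp (t • Y))) • origin K := by
    rw [twoExpCurve, ← mul_smul]
  -- the variation of the curve by the isometries `exp (s Z)`
  refine ⟨fun p ↦ (lieExp (p.1 • Z) : G) • twoExpCurve K X Y p.2,
    contMDiff_lieExp_smul_twoExpCurve h X Y Z, fun t ↦ ?_, ?_,
    ⟨innerL g (twoExpCurve K X Y t₀) (vel (twoExpCurve K X Y) t₀) (vel (twoExpCurve K X Y) t₀),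
      fun s ↦ ?_⟩, -(r * killing X Z), fun t ↦ ?_⟩
  · simp only [lieExp_zero_smul, one_smul]
  · simp only [hassoc]; exact hZ
  · simp only [vel_smul h _ (hγ.mdifferentiableAt (by simp))]
    exact innerL_smul hg.invariant _ _ _ _
  · simp only [hassoc, vel_lieExp_smul h, vel_twoExpCurve h]
    refine (innerL_smul hg.invariant _ _ _ _).trans ?_
    have hYP : ⁅Y, P⁆ = 0 := by rw [hY, smul_lie, lie_self, smul_zero]
    have hYm : Y ∈ 𝔪 i := (𝔪 i).smul_mem _ hP
    set Q' : LieAlg E G := Ad (lieExp ((-t) • Y)) Q with hQ'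
    have hQ'mem : Q' ∈ ⨆ j, ⨆ (_ : j ≠ i), 𝔪 j :=
      Ad_lieExp_mem (fun w hw ↦ hM.lie_mem_iSup hYm hw) (-t) hQ
    have hAdP : Ad (lieExp ((-t) • Y)) P = P := Ad_lieExp_eq_self hYP (-t)
    have hAdadd (U V : LieAlg E G) (b : G) : Ad b (U + V) = Ad b U + Ad b V :=
      map_add (AdL b : E →L[ℝ] E) U V
    have hAdsmul (a : ℝ) (U : LieAlg E G) (b : G) : Ad b (a • U) = a • Ad b U :=
      map_smul (AdL b : E →L[ℝ] E) a U
    have hXY : X + Y = Q + P := by rw [hX, hY]; module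
    have hvel : Ad (lieExp ((-t) • Y)) (X + Y) = Q' + P := by rw [hXY, hAdadd, hAdP]
    have hmom : Q' + c • P = Ad (lieExp ((-t) • Y)) X := by rw [hX, hAdadd, hAdsmul, hAdP]
    have hinv : Ad (lieExp (t • X) * lieExp (t • Y))⁻¹ Z =
        Ad (lieExp ((-t) • Y)) (Ad (lieExp ((-t) • X)) Z) := by
      rw [mul_inv_rev, ← lieExp_neg_smul, ← lieExp_neg_smul]
      exact congrArg (fun L : E →L[ℝ] E ↦ L Z) (AdL_mul _ _)
    rw [hvel, hinv]
    refine (innerL_dproj_add hM hg hi hj hP hQ'mem _).trans ?_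
    -- both arguments of `B` are now images under `Ad (exp (-t Y))`
    rw [hmom, killing_Ad_lieExp]
    have hAdX : Ad (lieExp ((-t) • X)) X = X := Ad_lieExp_eq_self (lie_self X) (-t)
    have hXZ := killing_Ad_lieExp X X Z (-t)
    rw [hAdX] at hXZ
    rw [hXZ]

/-- The initial velocity of `t ↦ exp (t X) exp (t Y) · o` is `X + Y`. -/
lemma velocity_twoExpCurve_zero (h : IsHomogeneousSpace E F K) (X Y : LieAlg E G) :
    velocity (twoExpCurve K X Y) 0 = tangentAtOrigin F K (X + Y) := by
  have h2 : vel (twoExpCurve K X Y) 0 = (diffL (proj K) (1 : G) : E →L[ℝ] F) (X + Y : E) := by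
    have h3 := hasMFDerivAt_proj_mul_curve (K := K) h (1 : G)
      (by simp only [lieExp_zero_smul, mul_one])
      (hasMFDerivAt_mul_curves (lieExp_zero_smul X) (lieExp_zero_smul Y)
        (hasMFDerivAt_lieExp_zero X) (hasMFDerivAt_lieExp_zero Y))
    have h4 : (originTranslation F K (1 : G)) = ContinuousLinearMap.id ℝ F := by
      have h5 : HasMFDerivAt 𝓘(ℝ, F) 𝓘(ℝ, F) (fun z : G ⧸ K ↦ (1 : G) • z) (origin K)
        (originTranslation F K (1 : G)) := hasMFDerivAt_smul h (1 : G) (origin K)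
      rw [show (fun z : G ⧸ K ↦ (1 : G) • z) = id from funext fun z ↦ one_smul G z] at h5
      exact hasMFDerivAt_unique h5 (hasMFDerivAt_id (origin K))
    rw [h4] at h3
    refine vel_eq_of_hasMFDerivAt (h3.congr_of_eventuallyEq (Eventually.of_forall fun s ↦ ?_))
    change proj K ((lieExp (s • X) * lieExp (s • Y)) * 1) = proj K _
    rw [mul_one, one_mul]
  have h6 : twoExpCurve K X Y 0 = origin K := by
    simp only [twoExpCurve, lieExp_zero_smul, one_smul, mul_one]
  -- equality of points of the tangent bundle, with both fibres read in `F`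
  have h7 : ∀ (p q : G ⧸ K) (a b : F), p = q → a = b →
      (⟨p, a⟩ : TangentBundle 𝓘(ℝ, F) (G ⧸ K)) = ⟨q, b⟩ := by
    rintro p q a b rfl rfl; rfl
  exact h7 _ _ _ _ h6 h2

theorem isTheGeodesic_twoExpCurve (hM : IsGeneralizedWallach E F K 𝔪)
    (hg : IsDiagonalMetric 𝔪 g l) {i : Fin 3} {r c : ℝ} (hi : l i = r * c)
    (hj : ∀ j, j ≠ i → l j = r) {P Q : LieAlg E G} (hP : P ∈ 𝔪 i)
    (hQ : Q ∈ ⨆ j, ⨆ (_ : j ≠ i), 𝔪 j) :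
    IsTheGeodesic g (tangentAtOrigin F K (Q + P))
      (twoExpCurve K (Q + c • P) ((1 - c) • P)) := by
  have hgeo := isGeodesicOn_twoExpCurve hM hg hi hj hP hQ
  have hv : velocity (twoExpCurve K (Q + c • P) ((1 - c) • P)) 0 =
      tangentAtOrigin F K (Q + P) := by
    rw [velocity_twoExpCurve_zero hM.homogeneous]
    congr 1
    module
  refine ⟨hgeo, hv, fun J σ hJ hJc h0 hσ hσv ↦ ?_⟩
  have : IsTopologicalGroup G := topologicalGroup_of_lieGroup 𝓘(ℝ, E) ∞
  have : IsClosed (K : Set G) := hM.isClosed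
  exact eqOn_of_isGeodesicOn hJ hJc hσ
    ⟨hgeo.1.mono (Set.subset_univ J), fun x t _ ↦ hgeo.2 x t (Set.mem_univ t)⟩ h0
    (hσv.trans hv.symm)

end Main

end

end GenWallach

theorem theorem4p2
    {E : Type*} [NormedAddCommGroup E] [NormedSpace ℝ E] [FiniteDimensional ℝ E] [CompleteSpace E]
    {G : Type*} [TopologicalSpace G] [ChartedSpace E G] [Group G] [LieGroup 𝓘(ℝ, E) ∞ G]
    [T2Space G] [ConnectedSpace G]
    {F : Type*} [NormedAddCommGroup F] [NormedSpace ℝ F] [FiniteDimensional ℝ F]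
    (K : Subgroup G) [ChartedSpace F (G ⧸ K)] [IsManifold 𝓘(ℝ, F) ∞ (G ⧸ K)]
    (𝔪 : Fin 3 → Submodule ℝ (GenWallach.LieAlg E G))
    (hM : GenWallach.IsGeneralizedWallach E F K 𝔪)
    (g : GenWallach.RiemMetric F (G ⧸ K))
    (X₁ X₂ X₃ : GenWallach.LieAlg E G) (hX₁ : X₁ ∈ 𝔪 0) (hX₂ : X₂ ∈ 𝔪 1) (hX₃ : X₃ ∈ 𝔪 2)
    (c r : ℝ) (hc : 0 < c) (hr : 0 < r) :
    (GenWallach.IsDiagonalMetric 𝔪 g ![r, r, r * c] →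
      GenWallach.IsTheGeodesic g (GenWallach.tangentAtOrigin F K (X₁ + X₂ + X₃))
        (GenWallach.twoExpCurve K (X₁ + X₂ + c • X₃) ((1 - c) • X₃))) ∧
    (GenWallach.IsDiagonalMetric 𝔪 g ![r, r * c, r] →
      GenWallach.IsTheGeodesic g (GenWallach.tangentAtOrigin F K (X₁ + X₂ + X₃))
        (GenWallach.twoExpCurve K (X₁ + c • X₂ + X₃) ((1 - c) • X₂))) ∧
    (GenWallach.IsDiagonalMetric 𝔪 g ![r * c, r, r] →
      GenWallach.IsTheGeodesic g (GenWallach.tangentAtOrigin F K (X₁ + X₂ + X₃))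
        (GenWallach.twoExpCurve K (c • X₁ + X₂ + X₃) ((1 - c) • X₁))) := by
  have hmem {i j : Fin 3} (hji : j ≠ i) {X : GenWallach.LieAlg E G} (hX : X ∈ 𝔪 j) :
      X ∈ ⨆ j, ⨆ (_ : j ≠ i), 𝔪 j :=
    Submodule.mem_iSup_of_mem j (Submodule.mem_iSup_of_mem hji hX)
  refine ⟨fun hg ↦ ?_, fun hg ↦ ?_, fun hg ↦ ?_⟩
  · exact GenWallach.isTheGeodesic_twoExpCurve hM hg (i := 2) (c := c) (r := r) rfl
      (by intro j; fin_cases j <;> simp) hX₃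
      (Submodule.add_mem _ (hmem (by decide) hX₁) (hmem (by decide) hX₂))
  · have h := GenWallach.isTheGeodesic_twoExpCurve hM hg (i := 1) (c := c) (r := r) rfl
      (by intro j; fin_cases j <;> simp) hX₂
      (Submodule.add_mem _ (hmem (by decide) hX₁) (hmem (by decide) hX₃))
    rwa [add_right_comm X₁ X₃ X₂, add_right_comm X₁ X₃ (c • X₂)] at h
  · have h := GenWallach.isTheGeodesic_twoExpCurve hM hg (i := 0) (c := c) (r := r) rfl
      (by intro j; fin_cases j <;> simp) hX₁
      (Submodule.add_mem _ (hmem (by decide) hX₂) (hmem (by decide) hX₃))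
    rwa [add_comm (X₂ + X₃) X₁, ← add_assoc, add_comm (X₂ + X₃) (c • X₁), ← add_assoc] at h
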